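/- Let $K$ be a field, let $q,Q\in K^\times$, and let $n,d\ge 0$ be integers. Put $r=\lfloor n/2\rfloor$ and let $I(n)=[-r,r]\cap\mathbb Z$ if $n$ is odd and $I(n)=([-r,r]\cap\mathbb Z)\setminus\{0\}$ if $n$ is even. Let $\mathcal H=\mathcal H^{\mathrm B}_{Q,q}(d)$ be the $K$-algebra generated by $T_0,\dots,T_{d-1}$ with relations $T_iT_{i+1}T_i=T_{i+1}T_iT_{i+1}$ ($1\le i\le d-2$), $(T_0T_1)^2=(T_1T_0)^2$, $T_iT_j=T_jT_i$ ($|i-j|>1$), $T_0^2=(Q^{-1}-Q)T_0+1$ and $T_i^2=(q^{-1}-q)T_i+1$ ($1\le i\le d-1$). Let $V$ be the $K$-space with basis $\{v_i\}_{i\in I(n)}$ and write $v_\mu=v_{\mu_1}\otimes\cdots\otimes v_{\mu_d}$ for $\mu\in I(n)^d$. The algebra $\mathcal H$ acts on $V^{\otimes d}$ from the right as follows. For $1\le t\le d-1$, let $\mu\cdot s_t$ be $\mu$ with the entries $\mu_t,\mu_{t+1}$ interchanged; then $v_\mu T_t$ is $v_{\mu\cdot s_t}$ if $\mu_t<\mu_{t+1}$,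 is $q^{-1}v_{\mu\cdot s_t}$ if $\mu_t=\mu_{t+1}$, and is $v_{\mu\cdot s_t}+(q^{-1}-q)v_\mu$ if $\mu_t>\mu_{t+1}$. Let $\mu\cdot s_0=(-\mu_1,\mu_2,\dots,\mu_d)$; then $v_\mu T_0$ is $v_{\mu\cdot s_0}$ if $\mu_1>0$, is $Q^{-1}v_{\mu\cdot s_0}$ if $\mu_1=0$, and is $v_{\mu\cdot s_0}+(Q^{-1}-Q)v_\mu$ if $\mu_1<0$. Let $S=S^{\mathrm B}_{Q,q}(n,d)=\mathrm{End}_{\mathcal H}(V^{\otimes d})$, acting on $V^{\otimes d}$ from the left. If $\lfloor n/2\rfloor\ge d$, then there are an idempotent $e\in S$ and an isomorphism of $K$-algebras $\psi:eSe\to\mathcal H$ such that the following hold. (a) $Se\cong V^{\otimes d}$ as $(S,\mathcal H)$-bimodules, where $S$ acts on $Se$ by left multiplication and $h\in\mathcal H$ acts by right multiplication with $\psi^{-1}(h)$. (b) Transposition of matrices with respect to the basis $\{v_\mu\}$ restricts to an anti-automorphism $\tau$ of the $K$-algebra $S$; there is an anti-automorphism $\sigma$ of the $K$-algebra $\mathcal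 H$ with $\sigma(T_t)=T_t$ for all $t$; and $eS\cong V^{\otimes d}$ as $(S,\mathcal H)$-bimodules, where $s\in S$ and $h\in\mathcal H$ act on $x\in eS$ by $s\cdot x=x\,\tau(s)$ and $x\cdot h=\psi^{-1}(\sigma(h))\,x$. (c) There is a functor from left $S$-modules to left $\mathcal H$-modules (the Schur functor of type B) that sends $M$ to $eM$, on which $h\in\mathcal H$ acts as $\psi^{-1}(h)\in eSe$, and that sends an $S$-linear map to its restriction. -/

import Mathlib

open MulOpposite

universe u w

namespace TypeB

/-- The index set `I(n)`: with `r = ⌊n/2⌋` it consists of the integers in `[-r, r]`,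
where `0` is left out if `n` is even. -/
abbrev Idx (n : ℕ) : Type :=
  {i : ℤ // i ∈ (Finset.Icc (-((n / 2 : ℕ) : ℤ)) ((n / 2 : ℕ) : ℤ)).filter
    (fun i => Odd n ∨ i ≠ 0)}

/-- The involution `i ↦ -i` of `I(n)`. -/
def Idx.neg {n : ℕ} (i : Idx n) : Idx n :=
  ⟨-i.1, by
    have h := i.2
    simp only [Finset.mem_filter, Finset.mem_Icc] at h ⊢
    refine ⟨⟨by linarith [h.1.2], by linarith [h.1.1]⟩, ?_⟩
    simpa using h.2⟩

section Hecke

variable {K : Type u} [Field K]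

/-- The defining relations of the two-parameter Hecke algebra of type B on the generators
`T_0, …, T_{d-1}`. -/
inductive HeckeRel (Q q : Kˣ) (d : ℕ) : FreeAlgebra K (Fin d) → FreeAlgebra K (Fin d) → Prop
  | braid (i j : Fin d) (hi : 1 ≤ i.val) (hj : j.val = i.val + 1) :
      HeckeRel Q q d
        (FreeAlgebra.ι K i * FreeAlgebra.ι K j * FreeAlgebra.ι K i)
        (FreeAlgebra.ι K j * FreeAlgebra.ι K i * FreeAlgebra.ι K j)
  | braid_zero (i j : Fin d) (hi : i.val = 0) (hj : j.val = 1) :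
      HeckeRel Q q d
        ((FreeAlgebra.ι K i * FreeAlgebra.ι K j) ^ 2)
        ((FreeAlgebra.ι K j * FreeAlgebra.ι K i) ^ 2)
  | comm (i j : Fin d) (hij : i.val + 1 < j.val) :
      HeckeRel Q q d
        (FreeAlgebra.ι K i * FreeAlgebra.ι K j)
        (FreeAlgebra.ι K j * FreeAlgebra.ι K i)
  | quad_zero (i : Fin d) (hi : i.val = 0) :
      HeckeRel Q q d
        (FreeAlgebra.ι K i ^ 2)
        (((↑Q⁻¹ : K) - (Q : K)) • FreeAlgebra.ι K i + 1)
  | quad (i : Fin d) (hi : 1 ≤ i.val) :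
      HeckeRel Q q d
        (FreeAlgebra.ι K i ^ 2)
        (((↑q⁻¹ : K) - (q : K)) • FreeAlgebra.ι K i + 1)

/-- The two-parameter Hecke algebra of type B. -/
def HeckeB (Q q : Kˣ) (d : ℕ) : Type u := RingQuot (HeckeRel Q q d)

noncomputable instance (Q q : Kˣ) (d : ℕ) : Ring (HeckeB Q q d) :=
  inferInstanceAs (Ring (RingQuot (HeckeRel Q q d)))

noncomputable instance (Q q : Kˣ) (d : ℕ) : Algebra K (HeckeB Q q d) :=
  inferInstanceAs (Algebra K (RingQuot (HeckeRel Q q d)))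

/-- The generator `T_t` of the Hecke algebra. -/
noncomputable def HeckeB.T (Q q : Kˣ) {d : ℕ} (t : Fin d) : HeckeB Q q d :=
  RingQuot.mkAlgHom K (HeckeRel Q q d) (FreeAlgebra.ι K t)

end Hecke

/-- The tensor space `V^{⊗d}`, where `V` is the `K`-space with basis indexed by `I(n)`. -/
def TensorSpace (K : Type u) [Field K] (n d : ℕ) : Type u :=
  PiTensorProduct K (fun _ : Fin d => (Idx n → K))

noncomputable instance (K : Type u) [Field K] (n d : ℕ) : AddCommGroup (TensorSpace K n d) :=
  inferInstanceAs (AddCommGroup (PiTensorProduct K (fun _ : Fin d => (Idx n → K))))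

noncomputable instance (K : Type u) [Field K] (n d : ℕ) : Module K (TensorSpace K n d) :=
  inferInstanceAs (Module K (PiTensorProduct K (fun _ : Fin d => (Idx n → K))))

/-- The basis `v_μ = v_{μ_1} ⊗ … ⊗ v_{μ_d}`, `μ ∈ I(n)^d`, of the tensor space. -/
noncomputable def tensorBasis (K : Type u) [Field K] (n d : ℕ) :
    Module.Basis (Fin d → Idx n) K (TensorSpace K n d) :=
  Basis.piTensorProduct (fun _ : Fin d => Pi.basisFun K (Idx n))

/-- The position before `t`. For `t ≠ 0` the generator `T_t` acts in the positions `t - 1` and `t`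
(the positions being counted from `0`). -/
def prevPos {d : ℕ} (t : Fin d) : Fin d := ⟨t.val - 1, by omega⟩

/-- The place permutation `μ · s_t`. -/
def placeAct {n d : ℕ} (t : Fin d) (μ : Fin d → Idx n) : Fin d → Idx n :=
  if t.val = 0 then Function.update μ t (μ t).neg
  else μ ∘ Equiv.swap (prevPos t) t

set_option linter.unusedSimpArgs false in
theorem braid_abs {K M α : Type*} [Field K] [AddCommGroup M] [Module K M] [LinearOrder α]
    (r : Kˣ) (G : α → α → α → M) (A B : Module.End K M)
    (hA1 : ∀ a b c, a < b → A (G a b c) = G b a c)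
    (hA2 : ∀ a c, A (G a a c) = (↑r⁻¹ : K) • G a a c)
    (hA3 : ∀ a b c, b < a → A (G a b c) = G b a c + ((↑r⁻¹ : K) - (r : K)) • G a b c)
    (hB1 : ∀ a b c, b < c → B (G a b c) = G a c b)
    (hB2 : ∀ a b, B (G a b b) = (↑r⁻¹ : K) • G a b b)
    (hB3 : ∀ a b c, c < b → B (G a b c) = G a c b + ((↑r⁻¹ : K) - (r : K)) • G a b c)
    (a b c : α) : A (B (A (G a b c))) = B (A (B (G a b c))) := by
  have hr : (↑r⁻¹ : K) * (r : K) = 1 := by simp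
  generalize (↑r⁻¹ : K) = x at *
  generalize (r : K) = y at *
  rcases lt_trichotomy a b with h1 | h1 | h1 <;> rcases lt_trichotomy b c with h2 | h2 | h2 <;>
    rcases lt_trichotomy a c with h3 | h3 | h3 <;> (try subst h1) <;> (try subst h2) <;>
    (try subst h3) <;>
    first
    | (exfalso; order)
    | (simp only [hA1, hA2, hA3, hB1, hB2, hB3, map_add, map_smul, *]; done)
    | (simp only [hA1, hA2, hA3, hB1, hB2, hB3, map_add, map_smul, *]; module)
    | (simp only [hA1, hA2, hA3, hB1, hB2, hB3, map_add, map_smul, *]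
       match_scalars <;> grind)

set_option linter.unusedSimpArgs false in
set_option maxHeartbeats 1000000 in
theorem braid0_abs {K M α : Type*} [Field K] [AddCommGroup M] [Module K M] [LinearOrder α]
    (ng : α → α) (val : α → ℤ) (hv : ∀ a b, a < b ↔ val a < val b)
    (hng : ∀ a, ng (ng a) = a) (hval : ∀ a, val (ng a) = - val a)
    (Q r : Kˣ) (G : α → α → M) (A B : Module.End K M)
    (hA1 : ∀ a b, 0 < val a → A (G a b) = G (ng a) b)
    (hA2 : ∀ a b, 0 = val a → A (G a b) = (↑Q⁻¹ : K) • G a b)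
    (hA3 : ∀ a b, val a < 0 → A (G a b) = G (ng a) b + ((↑Q⁻¹ : K) - (Q : K)) • G a b)
    (hB1 : ∀ b c, b < c → B (G b c) = G c b)
    (hB2 : ∀ b, B (G b b) = (↑r⁻¹ : K) • G b b)
    (hB3 : ∀ b c, c < b → B (G b c) = G c b + ((↑r⁻¹ : K) - (r : K)) • G b c)
    (a b : α) : B (A (B (A (G a b)))) = A (B (A (B (G a b)))) := by
  have hr : (↑r⁻¹ : K) * (r : K) = 1 := by simp
  have hQ : (↑Q⁻¹ : K) * (Q : K) = 1 := by simp
  generalize (↑r⁻¹ : K) = x at *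
  generalize (r : K) = y at *
  generalize (↑Q⁻¹ : K) = X at *
  generalize (Q : K) = Y at *
  have hinj : ∀ a b, val a = val b → a = b := by
    intro a b h
    rcases lt_trichotomy a b with h' | h' | h'
    · rw [hv] at h'; omega
    · exact h'
    · rw [hv] at h'; omega
  have hneg : ∀ a b, val a = - val b → a = ng b := fun a b h => hinj _ _ (by rw [hval, h])
  have hB1' : ∀ b c, val b < val c → B (G b c) = G c b := fun b c h => hB1 b c ((hv _ _).2 h)
  have hB3' : ∀ b c, val c < val b → B (G b c) = G c b + (x - y) • G b c :=
    fun b c h => hB3 b c ((hv _ _).2 h)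
  clear hB1 hB3 hv
  rcases lt_trichotomy (val a) (val b) with h1 | h1 | h1 <;>
    rcases lt_trichotomy (val a) (-val b) with h2 | h2 | h2 <;>
    rcases lt_trichotomy (val a) 0 with h3 | h3 | h3 <;>
    rcases lt_trichotomy (val b) 0 with h4 | h4 | h4 <;>
    first
    | (exfalso; omega)
    | skip
  all_goals try (obtain rfl := hinj _ _ h1)
  all_goals try (obtain rfl := hneg _ _ h2)
  all_goals try rw [hval] at h1
  all_goals try rw [hval] at h2
  all_goals try rw [hval] at h3
  all_goals first
    | (simp (disch := first | assumption | (simp only [hval]; omega) | omega) only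
        [hA1, hA2, hA3, hB1', hB2, hB3', hng, map_add, map_smul]; done)
    | (simp (disch := first | assumption | (simp only [hval]; omega) | omega) only
        [hA1, hA2, hA3, hB1', hB2, hB3', hng, map_add, map_smul]; module)
    | (simp (disch := first | assumption | (simp only [hval]; omega) | omega) only
        [hA1, hA2, hA3, hB1', hB2, hB3', hng, map_add, map_smul]
       match_scalars <;> grind)

section Action

variable {K : Type u} [Field K]

/-- The vector `v_μ T_t`. -/
noncomputable def basisAct (Q q : Kˣ) {n d : ℕ} (t : Fin d) (μ : Fin d → Idx n) :
    TensorSpace K n d :=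
  if t.val = 0 then
    if 0 < (μ t).1 then tensorBasis K n d (placeAct t μ)
    else if 0 = (μ t).1 then (↑Q⁻¹ : K) • tensorBasis K n d (placeAct t μ)
    else tensorBasis K n d (placeAct t μ) + ((↑Q⁻¹ : K) - (Q : K)) • tensorBasis K n d μ
  else
    if μ (prevPos t) < μ t then tensorBasis K n d (placeAct t μ)
    else if μ (prevPos t) = μ t then (↑q⁻¹ : K) • tensorBasis K n d (placeAct t μ)
    else tensorBasis K n d (placeAct t μ) + ((↑q⁻¹ : K) - (q : K)) • tensorBasis K n d μ

/-- The operator `v ↦ v T_t` on the tensor space. -/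
noncomputable def genAct (Q q : Kˣ) (n : ℕ) {d : ℕ} (t : Fin d) :
    Module.End K (TensorSpace K n d) :=
  (tensorBasis K n d).constr K (basisAct Q q t)

theorem genAct_zero (Q q : Kˣ) {n d : ℕ} (t : Fin d) (ht : t.val = 0) (μ : Fin d → Idx n) :
    genAct Q q n t (tensorBasis K n d μ) =
      if 0 < (μ t).1 then tensorBasis K n d (Function.update μ t (μ t).neg)
      else if 0 = (μ t).1 then (↑Q⁻¹ : K) • tensorBasis K n d (Function.update μ t (μ t).neg)
      else tensorBasis K n d (Function.update μ t (μ t).neg)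
        + ((↑Q⁻¹ : K) - (Q : K)) • tensorBasis K n d μ := by
  rw [genAct, Module.Basis.constr_basis, basisAct, if_pos ht, placeAct, if_pos ht]

theorem genAct_pos (Q q : Kˣ) {n d : ℕ} (s t : Fin d) (hst : t.val = s.val + 1)
    (μ : Fin d → Idx n) :
    genAct Q q n t (tensorBasis K n d μ) =
      if μ s < μ t then tensorBasis K n d (μ ∘ Equiv.swap s t)
      else if μ s = μ t then (↑q⁻¹ : K) • tensorBasis K n d (μ ∘ Equiv.swap s t)
      else tensorBasis K n d (μ ∘ Equiv.swap s t)
        + ((↑q⁻¹ : K) - (q : K)) • tensorBasis K n d μ := by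
  have hs : prevPos t = s := Fin.ext (by simp [prevPos, hst])
  have ht : t.val ≠ 0 := by omega
  rw [genAct, Module.Basis.constr_basis, basisAct, if_neg ht, placeAct, if_neg ht, hs]

theorem Idx.neg_neg {n : ℕ} (i : Idx n) : i.neg.neg = i := Subtype.ext (by simp [Idx.neg])

theorem genAct_quad_zero (Q q : Kˣ) {n d : ℕ} (t : Fin d) (ht : t.val = 0) :
    genAct Q q n t ^ 2 = ((↑Q⁻¹ : K) - (Q : K)) • genAct Q q n t + 1 := by
  refine (tensorBasis K n d).ext fun μ => ?_
  have hself : 0 = (μ t).1 → Function.update μ t (μ t).neg = μ := fun h => by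
    have : (μ t).neg = μ t := Subtype.ext (by simp [Idx.neg, ← h])
    rw [this, Function.update_eq_self]
  simp only [pow_two, Module.End.mul_apply, LinearMap.add_apply, LinearMap.smul_apply,
    Module.End.one_apply]
  rcases lt_trichotomy 0 (μ t).1 with h | h | h
  · have h' : ¬ 0 < (μ t).neg.1 := by simp only [Idx.neg]; omega
    have h'' : ¬ 0 = (μ t).neg.1 := by simp only [Idx.neg]; omega
    simp only [genAct_zero Q q t ht, if_pos h, Function.update_self, if_neg h', if_neg h'',
      Idx.neg_neg, Function.update_idem, Function.update_eq_self]
    module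
  · have h' : ¬ 0 < (μ t).1 := by omega
    simp only [genAct_zero Q q t ht, if_neg h', if_pos h, map_smul, hself h]
    match_scalars
    have hQ : (Q : K) ≠ 0 := Q.ne_zero
    field_simp
    ring
  · have h1 : ¬ 0 < (μ t).1 := by omega
    have h2 : ¬ 0 = (μ t).1 := by omega
    have h' : 0 < (μ t).neg.1 := by simp only [Idx.neg]; omega
    simp only [genAct_zero Q q t ht, if_neg h1, if_neg h2, Function.update_self, if_pos h',
      Idx.neg_neg, Function.update_idem, Function.update_eq_self, map_add, map_smul]
    module

theorem comp_swap_swap {ι α : Type*} [DecidableEq ι] (s t : ι) (μ : ι → α) :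
    (μ ∘ Equiv.swap s t) ∘ Equiv.swap s t = μ := by
  funext x; simp

theorem comp_swap_of_eq {ι α : Type*} [DecidableEq ι] (s t : ι) (μ : ι → α) (h : μ s = μ t) :
    μ ∘ Equiv.swap s t = μ := by
  funext x
  by_cases h1 : x = s
  · subst h1; simp [h]
  by_cases h2 : x = t
  · subst h2; simp [h]
  simp [Equiv.swap_apply_of_ne_of_ne h1 h2]

theorem genAct_quad (Q q : Kˣ) {n d : ℕ} (s t : Fin d) (hst : t.val = s.val + 1) :
    genAct Q q n t ^ 2 = ((↑q⁻¹ : K) - (q : K)) • genAct Q q n t + 1 := by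
  refine (tensorBasis K n d).ext fun μ => ?_
  simp only [pow_two, Module.End.mul_apply, LinearMap.add_apply, LinearMap.smul_apply,
    Module.End.one_apply]
  rcases lt_trichotomy (μ s) (μ t) with h | h | h
  · have h1 : ¬ μ t < μ s := h.asymm
    have h2 : ¬ μ t = μ s := h.ne'
    simp only [genAct_pos Q q s t hst, if_pos h, Function.comp_apply, Equiv.swap_apply_left,
      Equiv.swap_apply_right, if_neg h1, if_neg h2, comp_swap_swap]
    module
  · have h' : ¬ μ s < μ t := h.not_lt
    simp only [genAct_pos Q q s t hst, if_neg h', if_pos h, map_smul, comp_swap_of_eq s t μ h]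
    match_scalars
    have hq : (q : K) ≠ 0 := q.ne_zero
    field_simp
    ring
  · have h1 : ¬ μ s < μ t := h.asymm
    have h2 : ¬ μ s = μ t := h.ne'
    simp only [genAct_pos Q q s t hst, if_pos h, Function.comp_apply, Equiv.swap_apply_left,
      Equiv.swap_apply_right, if_neg h1, if_neg h2, comp_swap_swap, map_add, map_smul]
    module

theorem genAct_braid (Q q : Kˣ) {n d : ℕ} (i j : Fin d) (hi : 1 ≤ i.val)
    (hj : j.val = i.val + 1) :
    genAct Q q n i * genAct Q q n j * genAct Q q n i =
      genAct (K := K) Q q n j * genAct Q q n i * genAct Q q n j := by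
  obtain ⟨p, hp⟩ : ∃ p : Fin d, i.val = p.val + 1 := ⟨⟨i.val - 1, by omega⟩, by simp; omega⟩
  have hpi : p ≠ i := fun h => by rw [h] at hp; omega
  have hpj : p ≠ j := fun h => by rw [h] at hp; omega
  have hij : i ≠ j := fun h => by rw [h] at hj; omega
  refine (tensorBasis K n d).ext fun μ => ?_
  let F : Idx n → Idx n → Idx n → (Fin d → Idx n) := fun a b c =>
    Function.update (Function.update (Function.update μ p a) i b) j c
  have Fp : ∀ a b c, F a b c p = a := fun a b c => by simp [F, hpi, hpj]
  have Fi : ∀ a b c, F a b c i = b := fun a b c => by simp [F, hij]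
  have Fj : ∀ a b c, F a b c j = c := fun a b c => by simp [F]
  have Fo : ∀ a b c x, x ≠ p → x ≠ i → x ≠ j → F a b c x = μ x := fun a b c x h1 h2 h3 => by
    simp [F, h1, h2, h3]
  have S1 : ∀ a b c, F a b c ∘ Equiv.swap p i = F b a c := fun a b c => by
    funext x
    by_cases h1 : x = p
    · subst h1; simp [Fp, Fi]
    by_cases h2 : x = i
    · subst h2; simp [Fp, Fi]
    by_cases h3 : x = j
    · subst h3; simp [Equiv.swap_apply_of_ne_of_ne h1 h2, Fj]
    simp [Equiv.swap_apply_of_ne_of_ne h1 h2, Fo _ _ _ x h1 h2 h3]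
  have S2 : ∀ a b c, F a b c ∘ Equiv.swap i j = F a c b := fun a b c => by
    funext x
    by_cases h2 : x = i
    · subst h2; simp [Fj, Fi]
    by_cases h3 : x = j
    · subst h3; simp [Fj, Fi]
    by_cases h1 : x = p
    · subst h1; simp [Equiv.swap_apply_of_ne_of_ne h2 h3, Fp]
    simp [Equiv.swap_apply_of_ne_of_ne h2 h3, Fo _ _ _ x h1 h2 h3]
  have hμ : F (μ p) (μ i) (μ j) = μ := by simp [F]
  have key := braid_abs q (fun a b c => tensorBasis K n d (F a b c))
    (genAct Q q n i) (genAct Q q n j)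
    (fun a b c h => by simp only [genAct_pos Q q p i hp, Fp, Fi, S1, if_pos h])
    (fun a c => by simp only [genAct_pos Q q p i hp, Fp, Fi, S1, lt_irrefl, if_false, if_true])
    (fun a b c h => by simp only [genAct_pos Q q p i hp, Fp, Fi, S1, if_neg h.asymm, if_neg h.ne'])
    (fun a b c h => by simp only [genAct_pos Q q i j hj, Fj, Fi, S2, if_pos h])
    (fun a b => by simp only [genAct_pos Q q i j hj, Fj, Fi, S2, lt_irrefl, if_false, if_true])
    (fun a b c h => by simp only [genAct_pos Q q i j hj, Fj, Fi, S2, if_neg h.asymm, if_neg h.ne'])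
    (μ p) (μ i) (μ j)
  simp only [hμ] at key
  simpa only [Module.End.mul_apply] using key

theorem genAct_braid_zero (Q q : Kˣ) {n d : ℕ} (i j : Fin d) (hi : i.val = 0)
    (hj : j.val = 1) :
    (genAct Q q n i * genAct Q q n j) ^ 2 =
      (genAct (K := K) Q q n j * genAct Q q n i) ^ 2 := by
  have hij : i ≠ j := fun h => by rw [h] at hi; omega
  have hji : j.val = i.val + 1 := by omega
  refine (tensorBasis K n d).ext fun μ => ?_
  let F : Idx n → Idx n → (Fin d → Idx n) := fun a b =>
    Function.update (Function.update μ i a) j b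
  have Fi : ∀ a b, F a b i = a := fun a b => by simp [F, hij]
  have Fj : ∀ a b, F a b j = b := fun a b => by simp [F]
  have S1 : ∀ a b c, Function.update (F a b) i c = F c b := fun a b c => by
    simp only [F]
    rw [Function.update_comm hij.symm, Function.update_idem, Function.update_comm hij]
  have S2 : ∀ a b, F a b ∘ Equiv.swap i j = F b a := fun a b => by
    funext x
    by_cases h2 : x = i
    · subst h2; simp [Fj, Fi]
    by_cases h3 : x = j
    · subst h3; simp [Fj, Fi]
    simp [Equiv.swap_apply_of_ne_of_ne h2 h3, F, h2, h3]
  have hμ : F (μ i) (μ j) = μ := by simp [F]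
  have key := braid0_abs (Idx.neg (n := n)) (fun a => a.1) (fun a b => Iff.rfl)
    Idx.neg_neg (fun a => rfl) Q q (fun a b => tensorBasis K n d (F a b))
    (genAct Q q n i) (genAct Q q n j)
    (fun a b h => by simp only [genAct_zero Q q i hi, Fi, S1, if_pos h])
    (fun a b h => by
      have h' : ¬ 0 < a.1 := by omega
      have h'' : a.neg = a := Subtype.ext (by simp [Idx.neg, ← h])
      simp only [genAct_zero Q q i hi, Fi, S1, if_neg h', if_pos h, h''])
    (fun a b h => by
      have h' : ¬ 0 < a.1 := by omega
      have h'' : ¬ 0 = a.1 := by omega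
      simp only [genAct_zero Q q i hi, Fi, S1, if_neg h', if_neg h''])
    (fun b c h => by simp only [genAct_pos Q q i j hji, Fj, Fi, S2, if_pos h])
    (fun b => by simp only [genAct_pos Q q i j hji, Fj, Fi, S2, lt_irrefl, if_false, if_true])
    (fun b c h => by simp only [genAct_pos Q q i j hji, Fj, Fi, S2, if_neg h.asymm, if_neg h.ne'])
    (μ i) (μ j)
  simp only [hμ] at key
  simpa only [pow_two, Module.End.mul_apply] using key.symm

/-- Operators of the form `b μ ↦ x μ • b (f μ) + y μ • b μ` that do not interact commute. -/
theorem comm_abs {ι M : Type*} [AddCommGroup M] [Module K M] (b : ι → M) (A B : Module.End K M)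
    (f g : ι → ι) (x y x' y' : ι → K)
    (hA : ∀ μ, A (b μ) = x μ • b (f μ) + y μ • b μ)
    (hB : ∀ μ, B (b μ) = x' μ • b (g μ) + y' μ • b μ)
    (hfg : ∀ μ, f (g μ) = g (f μ)) (hx : ∀ μ, x (g μ) = x μ) (hy : ∀ μ, y (g μ) = y μ)
    (hx' : ∀ μ, x' (f μ) = x' μ) (hy' : ∀ μ, y' (f μ) = y' μ) (μ : ι) :
    A (B (b μ)) = B (A (b μ)) := by
  simp only [hA, hB, map_add, map_smul, hfg, hx, hy, hx', hy']
  module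

theorem genAct_comm (Q q : Kˣ) {n d : ℕ} (i j : Fin d) (hij : i.val + 1 < j.val) :
    genAct Q q n i * genAct Q q n j = genAct (K := K) Q q n j * genAct Q q n i := by
  obtain ⟨p, hp⟩ : ∃ p : Fin d, j.val = p.val + 1 := ⟨⟨j.val - 1, by omega⟩, by simp; omega⟩
  have hip : i ≠ p := fun h => by rw [h] at hij; omega
  have hij' : i ≠ j := fun h => by rw [h] at hij; omega
  refine (tensorBasis K n d).ext fun μ => ?_
  have hB : ∀ μ, genAct Q q n j (tensorBasis K n d μ) =
      (if μ p = μ j then (↑q⁻¹ : K) else 1) • tensorBasis K n d (μ ∘ Equiv.swap p j) +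
      (if μ p ≤ μ j then 0 else (↑q⁻¹ : K) - (q : K)) • tensorBasis K n d μ := fun μ => by
    rw [genAct_pos Q q p j hp]
    rcases lt_trichotomy (μ p) (μ j) with h | h | h
    · simp [h, h.le, h.ne]
    · simp [h]
    · simp [h.asymm, h.ne', h.not_ge]
  by_cases hi : i.val = 0
  · have hA : ∀ μ, genAct Q q n i (tensorBasis K n d μ) =
        (if 0 = (μ i).1 then (↑Q⁻¹ : K) else 1) •
          tensorBasis K n d (Function.update μ i (μ i).neg) +
        (if 0 ≤ (μ i).1 then 0 else (↑Q⁻¹ : K) - (Q : K)) • tensorBasis K n d μ := fun μ => by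
      rw [genAct_zero Q q i hi]
      rcases lt_trichotomy 0 (μ i).1 with h | h | h
      · simp [h, h.le, h.ne]
      · simp [← h]
      · simp [h.asymm, h.ne', h.not_ge]
    refine comm_abs (tensorBasis K n d) _ _ _ _ _ _ _ _ hA hB ?_ ?_ ?_ ?_ ?_ μ
    · intro μ
      funext x
      by_cases h1 : x = i
      · subst h1; simp [Equiv.swap_apply_of_ne_of_ne hip hij']
      have h1' : Equiv.swap p j x ≠ i := fun h => h1 (by
        rw [← Equiv.swap_apply_of_ne_of_ne hip hij'] at h
        exact (Equiv.swap p j).injective h)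
      simp [h1, h1']
    all_goals intro μ
    all_goals simp [Equiv.swap_apply_of_ne_of_ne hip hij', hip.symm, hij'.symm]
  · obtain ⟨s, hs⟩ : ∃ s : Fin d, i.val = s.val + 1 := ⟨⟨i.val - 1, by omega⟩, by simp; omega⟩
    have hsp : s ≠ p := fun h => by rw [h] at hs; omega
    have hsj : s ≠ j := fun h => by rw [h] at hs; omega
    have hA : ∀ μ, genAct Q q n i (tensorBasis K n d μ) =
        (if μ s = μ i then (↑q⁻¹ : K) else 1) • tensorBasis K n d (μ ∘ Equiv.swap s i) +
        (if μ s ≤ μ i then 0 else (↑q⁻¹ : K) - (q : K)) • tensorBasis K n d μ := fun μ => by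
      rw [genAct_pos Q q s i hs]
      rcases lt_trichotomy (μ s) (μ i) with h | h | h
      · simp [h, h.le, h.ne]
      · simp [h]
      · simp [h.asymm, h.ne', h.not_ge]
    refine comm_abs (tensorBasis K n d) _ _ _ _ _ _ _ _ hA hB ?_ ?_ ?_ ?_ ?_ μ
    · intro μ
      have hc : Commute (Equiv.swap p j) (Equiv.swap s i) :=
        (Equiv.Perm.disjoint_swap_swap (by simp [*, hsp.symm, hip.symm, hsj.symm, hij'.symm,
          show p ≠ j from fun h => by rw [h] at hp; omega,
          show s ≠ i from fun h => by rw [h] at hs; omega])).commute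
      funext x
      exact congrArg μ (Equiv.Perm.ext_iff.1 hc.eq x)
    all_goals intro μ
    all_goals simp [Equiv.swap_apply_of_ne_of_ne hip hij', Equiv.swap_apply_of_ne_of_ne hsp hsj,
      Equiv.swap_apply_of_ne_of_ne hsp.symm hip.symm,
      Equiv.swap_apply_of_ne_of_ne hsj.symm hij'.symm]

/-- The right action of the Hecke algebra on the tensor space: the generator `T_t` acts by
`v ↦ v T_t`. -/
noncomputable def heckeAct (Q q : Kˣ) (n d : ℕ) :
    HeckeB Q q d →ₐ[K] (Module.End K (TensorSpace K n d))ᵐᵒᵖ :=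
  RingQuot.liftAlgHom K
    ⟨FreeAlgebra.lift K (fun t : Fin d => op (genAct Q q n t)), by
      intro x y h
      cases h with
      | braid i j hi hj =>
        simp only [map_mul, FreeAlgebra.lift_ι_apply, ← op_mul, ← mul_assoc]
        rw [genAct_braid Q q i j hi hj]
      | braid_zero i j hi hj =>
        simp only [map_mul, map_pow, FreeAlgebra.lift_ι_apply, ← op_mul, ← op_pow]
        rw [genAct_braid_zero Q q i j hi hj]
      | comm i j hij =>
        simp only [map_mul, FreeAlgebra.lift_ι_apply, ← op_mul]
        rw [genAct_comm Q q i j hij]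
      | quad_zero i hi =>
        simp only [map_add, map_smul, map_one, map_pow, FreeAlgebra.lift_ι_apply, ← op_pow]
        rw [genAct_quad_zero Q q i hi, MulOpposite.op_add, MulOpposite.op_smul,
          MulOpposite.op_one]
      | quad i hi =>
        simp only [map_add, map_smul, map_one, map_pow, FreeAlgebra.lift_ι_apply, ← op_pow]
        rw [genAct_quad Q q ⟨i.val - 1, by omega⟩ i (by simp; omega), MulOpposite.op_add, MulOpposite.op_smul,
          MulOpposite.op_one]⟩

/-- The tensor space as a right module over the Hecke algebra. -/
noncomputable instance (Q q : Kˣ) (n d : ℕ) :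
    Module (HeckeB Q q d)ᵐᵒᵖ (TensorSpace K n d) :=
  Module.compHom (TensorSpace K n d) (AlgHom.opComm (heckeAct Q q n d)).toRingHom

theorem op_smul_def (Q q : Kˣ) {n d : ℕ} (h : HeckeB Q q d) (v : TensorSpace K n d) :
    op h • v = (heckeAct Q q n d h).unop v := rfl

theorem op_T_smul (Q q : Kˣ) {n d : ℕ} (t : Fin d) (μ : Fin d → Idx n) :
    op (HeckeB.T Q q t) • tensorBasis K n d μ = basisAct Q q t μ := by
  rw [op_smul_def, HeckeB.T, heckeAct]
  erw [RingQuot.liftAlgHom_mkAlgHom_apply]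
  rw [FreeAlgebra.lift_ι_apply, unop_op, genAct, Module.Basis.constr_basis]

instance (Q q : Kˣ) (n d : ℕ) : SMulCommClass (HeckeB Q q d)ᵐᵒᵖ K (TensorSpace K n d) where
  smul_comm h c v := ((heckeAct Q q n d h.unop).unop.map_smul c v)

instance (Q q : Kˣ) (n d : ℕ) : SMulCommClass K (HeckeB Q q d)ᵐᵒᵖ (TensorSpace K n d) :=
  SMulCommClass.symm _ _ _

instance (Q q : Kˣ) (n d : ℕ) : IsScalarTower K (HeckeB Q q d)ᵐᵒᵖ (TensorSpace K n d) where
  smul_assoc c h v := by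
    change (heckeAct Q q n d (c • h.unop)).unop v = c • (heckeAct Q q n d h.unop).unop v
    rw [map_smul]
    rfl

/-- The `q`-Schur algebra of type B: the algebra of endomorphisms of the right module `V^{⊗d}`
over the Hecke algebra, acting on `V^{⊗d}` from the left. -/
abbrev SchurB (Q q : Kˣ) (n d : ℕ) : Type u :=
  Module.End (HeckeB Q q d)ᵐᵒᵖ (TensorSpace K n d)

end Action

/-- The corner `e A e` of a `K`-algebra is a `K`-algebra with unit `e`. -/
instance cornerAlgebra {K A : Type*} [CommSemiring K] [Ring A] [Algebra K A] {e : A}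
    (he : IsIdempotentElem e) : Algebra K he.Corner where
  smul c x := ⟨c • x.1, by
    obtain ⟨y, hy⟩ := x.2
    exact ⟨c • y, by rw [← hy]; simp⟩⟩
  algebraMap :=
    { toFun := fun c => ⟨c • e, ⟨c • e, by simp [he.eq]⟩⟩
      map_one' := Subtype.ext (one_smul K e)
      map_mul' := fun a b => Subtype.ext (by
        change (a * b) • e = (a • e) * (b • e)
        rw [smul_mul_smul_comm, he.eq])
      map_zero' := Subtype.ext (zero_smul K e)
      map_add' := fun a b => Subtype.ext (add_smul a b e) }
  commutes' c x := Subtype.ext (by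
    have h := (Subsemigroup.mem_corner_iff he).1 x.2
    change (c • e) * x.1 = x.1 * (c • e)
    rw [smul_mul_assoc, mul_smul_comm, h.1, h.2])
  smul_def' c x := Subtype.ext (by
    have h := (Subsemigroup.mem_corner_iff he).1 x.2
    change c • x.1 = (c • e) * x.1
    rw [smul_mul_assoc, h.1])

/-- The additive group `e M` for an element `e` of a ring and a left module `M`. -/
def idemPart {A : Type*} [Ring A] (e : A) (M : Type*) [AddCommGroup M] [Module A M] :
    AddSubgroup M :=
  (DistribSMul.toAddMonoidHom M e).range

end TypeB

/-! Since d ≤ ⌊n/2⌋, there is a basis tensor v₀ = v_1 ⊗ ⋯ ⊗ v_d whose entries are nonzero with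
distinct absolute values. Its orbit under the group W of signed permutations is therefore free, with
2^d d! elements, and on the orbit the generators act as on a regular module: T_u sends v_w to
v_{ws_u}, plus a multiple of v_w if u is a descent of w (`genAct_orbitVec`). The span N of the orbit
and the span of the remaining basis tensors are both stable under the Hecke algebra H, so the
projection e onto N lies in S.

The map h ↦ v₀h from H to N is onto, because each signed permutation is reached from the identity
through ascents (`SignedPerm.induction_ascent`). A spanning set built from coset representatives
gives dim H ≤ 2^d d! (`HeckeB.finrank_le`), so the map is an isomorphism (`orbitMap_injective`). The
basis theorem for H is not presupposed: the upper bound comes from the relations, the lower bound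
from this very action.

Hence e is the operator w ↦ v₀β(w) for an H-linear β from the tensor space to H with β(v₀) = 1.
Everything in (a) follows formally from such a pair: v ↦ (w ↦ vβ(w)) identifies the tensor space
with Se, and f ↦ β(f v₀) identifies eSe with H. Part (c) holds for every idempotent and every ring
mapping to its corner.

For (b), each T_t has a symmetric matrix, so its commutant S is closed under transposition; e is
diagonal, so eS = τ(Se). What remains is τψ⁻¹ = ψ⁻¹σ (`transposeEquiv_rankOne`), which need only be
checked on generators. There ψ⁻¹(T_t) is left multiplication by T_t on N ≅ H; its explicit matrix is
symmetric as well. That the explicit operator commutes with the right action (`leftMulEnd_comm`)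
rests on how left multiplication moves right descents (`SignedPerm.desc_left`). -/

namespace TypeB

/-! ### Upper bound for the dimension: spanning sets from coset representatives. -/

section Spanning

open scoped Pointwise

/-- A family of elements of an algebra that satisfies the braid relations of type B and quadratic
relations up to the index `d`. -/
structure IsHeckeFamily (K : Type*) {A : Type*} [Field K] [Ring A] [Algebra K A]
    (T : ℕ → A) (d : ℕ) : Prop where
  comm : ∀ i j, i + 1 < j → j < d → T i * T j = T j * T i
  braid : ∀ i, 1 ≤ i → i + 1 < d → T i * T (i + 1) * T i = T (i + 1) * T i * T (i + 1)
  braid_zero : 1 < d → T 0 * T 1 * T 0 * T 1 = T 1 * T 0 * T 1 * T 0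
  quad : ∀ i < d, ∃ c : K, T i * T i = c • T i + 1

/-- The product `T_p T_{p-1} ⋯` with `j` factors. -/
def descProd {A : Type*} [Monoid A] (T : ℕ → A) (p : ℕ) : ℕ → A
  | 0 => 1
  | j + 1 => descProd T p j * T (p - j)

/-- The product `T_p ⋯ T_1 T_0 T_1 ⋯ T_k`. -/
def ascProd {A : Type*} [Monoid A] (T : ℕ → A) (p : ℕ) : ℕ → A
  | 0 => descProd T p (p + 1)
  | k + 1 => ascProd T p k * T (k + 1)

variable {K A : Type*} [Field K] [Ring A] [Algebra K A] {T : ℕ → A} {p : ℕ}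

theorem IsHeckeFamily.mono {d e : ℕ} (h : IsHeckeFamily K T e) (hde : d ≤ e) :
    IsHeckeFamily K T d where
  comm i j hij hj := h.comm i j hij (by omega)
  braid i hi hj := h.braid i hi (by omega)
  braid_zero hd := h.braid_zero (by omega)
  quad i hi := h.quad i (by omega)

theorem IsHeckeFamily.descProd_mul_of_lt (h : IsHeckeFamily K T (p + 1)) (i j : ℕ)
    (hij : i + j < p) :
    descProd T p j * T i = T i * descProd T p j := by
  induction j with
  | zero => simp [descProd]
  | succ j ih =>
    rw [descProd, mul_assoc, ← h.comm i (p - j) (by omega) (by omega), ← mul_assoc,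
      ih (by omega), mul_assoc]

/-- Both T_{t+1} and T_t occur in the product. The new factor moves left to them, the braid relation
turns T_{t+1} T_t T_{t+1} into T_t T_{t+1} T_t, and the first T_t commutes with all larger indices
before it. The index 0 is excluded because T_0 and T_1 satisfy only the braid relation of length
four. -/
theorem IsHeckeFamily.descProd_mul_of_gt (h : IsHeckeFamily K T (p + 1)) (t j : ℕ) (ht : 1 ≤ t)
    (hj : j ≤ p + 1) (htj : p < t + j) (htp : t + 1 ≤ p) :
    descProd T p j * T (t + 1) = T t * descProd T p j := by
  induction j with
  | zero => omega
  | succ j ih =>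
    by_cases hk : p < t + j
    · rw [descProd, mul_assoc, h.comm (p - j) (t + 1) (by omega) (by omega), ← mul_assoc,
        ih (by omega) hk, mul_assoc]
    · obtain ⟨i, rfl⟩ : ∃ i, j = i + 1 := ⟨j - 1, by omega⟩
      have h1 : p - (i + 1) = t := by omega
      have h2 : p - i = t + 1 := by omega
      rw [descProd, descProd, h1, h2]
      calc descProd T p i * T (t + 1) * T t * T (t + 1)
          = descProd T p i * (T (t + 1) * T t * T (t + 1)) := by simp only [mul_assoc]
        _ = descProd T p i * T t * T (t + 1) * T t := by
          rw [← h.braid t ht (by omega)]; simp only [mul_assoc]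
        _ = _ := by rw [h.descProd_mul_of_lt t i (by omega)]; simp only [mul_assoc]

theorem IsHeckeFamily.ascProd_mul_of_gt (h : IsHeckeFamily K T (p + 1)) (t k : ℕ) (hkt : k < t)
    (htp : t + 1 ≤ p) : ascProd T p k * T (t + 1) = T t * ascProd T p k := by
  induction k with
  | zero => exact h.descProd_mul_of_gt t _ (by omega) le_rfl (by omega) htp
  | succ k ih =>
    rw [ascProd, mul_assoc, h.comm (k + 1) (t + 1) (by omega) (by omega), ← mul_assoc,
      ih (by omega), mul_assoc]

/-- The braid relation in the ascending half replaces T_t by T_{t+1}, and passing the descending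
half lowers the index back to t. For t = 0 the relation of length four at the turning point does
this directly. -/
theorem IsHeckeFamily.ascProd_mul_of_lt (h : IsHeckeFamily K T (p + 1)) (t k : ℕ) (htk : t < k)
    (hkp : k ≤ p) : ascProd T p k * T t = T t * ascProd T p k := by
  induction k with
  | zero => omega
  | succ k ih =>
    rcases Nat.lt_or_ge t k with htk' | htk'
    · rw [ascProd, mul_assoc, ← h.comm t (k + 1) (by omega) (by omega), ← mul_assoc,
        ih htk' (by omega), mul_assoc]
    obtain rfl : t = k := by omega
    rcases t with _ | t
    · obtain ⟨p, rfl⟩ : ∃ m, p = m + 1 := ⟨p - 1, by omega⟩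
      have h1 : p + 1 - p = 1 := by omega
      have h2 : p + 1 - (p + 1) = 0 := by omega
      rw [ascProd, ascProd, descProd, descProd, h1, h2, zero_add]
      calc descProd T (p + 1) p * T 1 * T 0 * T 1 * T 0
          = descProd T (p + 1) p * (T 1 * T 0 * T 1 * T 0) := by simp only [mul_assoc]
        _ = descProd T (p + 1) p * T 0 * T 1 * T 0 * T 1 := by
          rw [← h.braid_zero (by omega)]; simp only [mul_assoc]
        _ = _ := by rw [h.descProd_mul_of_lt 0 p (by omega)]; simp only [mul_assoc]
    · rw [ascProd, ascProd]
      calc ascProd T p t * T (t + 1) * T (t + 1 + 1) * T (t + 1)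
          = ascProd T p t * (T (t + 1) * T (t + 1 + 1) * T (t + 1)) := by simp only [mul_assoc]
        _ = ascProd T p t * T (t + 1 + 1) * T (t + 1) * T (t + 1 + 1) := by
          rw [h.braid (t + 1) (by omega) (by omega)]; simp only [mul_assoc]
        _ = _ := by rw [h.ascProd_mul_of_gt (t + 1) t (by omega) hkp]; simp only [mul_assoc]

open scoped Classical in
/-- The products `T_p ⋯ T_k` and `T_p ⋯ T_0 ⋯ T_k`; they represent the right cosets of the
parabolic subgroup generated by the reflections `s_0, …, s_{p-1}`. -/
noncomputable def cosetProds (T : ℕ → A) (p : ℕ) : Finset A :=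
  (Finset.range (p + 2)).image (descProd T p) ∪
    (Finset.range p).image (fun k => ascProd T p (k + 1))

theorem card_cosetProds_le (T : ℕ → A) (p : ℕ) : (cosetProds T p).card ≤ 2 * (p + 1) := by
  classical
  calc (cosetProds T p).card ≤ (p + 2) + p := by
        rw [cosetProds]
        refine (Finset.card_union_le _ _).trans (Nat.add_le_add ?_ ?_)
        · exact Finset.card_image_le.trans (Finset.card_range _).le
        · exact Finset.card_image_le.trans (Finset.card_range _).le
    _ = 2 * (p + 1) := by ring

theorem descProd_mem {j : ℕ} (hj : j ≤ p + 1) : descProd T p j ∈ cosetProds T p := by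
  classical
  exact Finset.mem_union_left _ (Finset.mem_image_of_mem _ (Finset.mem_range.2 (by omega)))

theorem ascProd_mem {k : ℕ} (hk : k ≤ p) : ascProd T p k ∈ cosetProds T p := by
  classical
  rcases k with _ | k
  · exact descProd_mem le_rfl
  · exact Finset.mem_union_right _
      (Finset.mem_image.2 ⟨k, Finset.mem_range.2 (by omega), rfl⟩)

/-- Deodhar's alternative for coset representatives: y T_t is again a representative, or is reduced
by the quadratic relation to a combination of two representatives, or equals T_s y with s < p, and
then T_s is absorbed by `N`. -/
theorem IsHeckeFamily.mem_mul_span_cosetProds (h : IsHeckeFamily K T (p + 1)) (N : Submodule K A)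
    (hN : ∀ t < p, ∀ x ∈ N, x * T t ∈ N) {x y : A} (hx : x ∈ N) (hy : y ∈ cosetProds T p)
    {t : ℕ} (ht : t < p + 1) :
    x * (y * T t) ∈ N * Submodule.span K (cosetProds T p : Set A) := by
  classical
  have hmem : ∀ {x y : A}, x ∈ N → y ∈ cosetProds T p →
      x * y ∈ N * Submodule.span K (cosetProds T p : Set A) := fun hx hy =>
    Submodule.mul_mem_mul hx (Submodule.subset_span hy)
  have hquad : ∀ {z : A} {i : ℕ}, i < p + 1 → z ∈ cosetProds T p → z * T i ∈ cosetProds T p →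
      x * (z * T i * T i) ∈ N * Submodule.span K (cosetProds T p : Set A) := by
    intro z i hi hz hzi
    obtain ⟨c, hc⟩ := h.quad i hi
    rw [mul_assoc z, hc, mul_add, mul_add, mul_one, mul_smul_comm, mul_smul_comm]
    exact add_mem (Submodule.smul_mem _ _ (hmem hx hzi)) (hmem hx hz)
  have hleft : ∀ {y : A} {s : ℕ}, s < p → y ∈ cosetProds T p → y * T t = T s * y →
      x * (y * T t) ∈ N * Submodule.span K (cosetProds T p : Set A) := by
    intro y s hs hy e
    rw [e, ← mul_assoc]
    exact hmem (hN s hs x hx) hy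
  have hasc : ∀ k ≤ p, y = ascProd T p k → 1 ≤ k →
      x * (y * T t) ∈ N * Submodule.span K (cosetProds T p : Set A) := by
    rintro k hk rfl hk1
    rcases lt_trichotomy t k with htk | rfl | htk
    · exact hleft (by omega) hy (h.ascProd_mul_of_lt t k htk hk)
    · obtain ⟨s, rfl⟩ : ∃ s, t = s + 1 := ⟨t - 1, by omega⟩
      exact hquad ht (ascProd_mem (by omega)) hy
    · rcases Nat.lt_or_ge (k + 1) t with htk' | htk'
      · obtain ⟨s, rfl⟩ : ∃ s, t = s + 1 := ⟨t - 1, by omega⟩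
        exact hleft (by omega) hy (h.ascProd_mul_of_gt s k (by omega) (by omega))
      · obtain rfl : t = k + 1 := by omega
        exact hmem hx (ascProd_mem (k := k + 1) (by omega))
  rcases Finset.mem_union.1 hy with hy' | hy'
  · obtain ⟨j, hj, rfl⟩ := Finset.mem_image.1 hy'
    rw [Finset.mem_range] at hj
    -- The last factor of the product is T_{p-j+1}. So t + j < p means that T_t commutes with all
    -- factors, t + j = p extends the product, t + j = p + 1 repeats the last factor, and beyond
    -- that the index is shifted. The exception is T_1 after the full product down to T_0, which
    -- starts the ascending half.
    rcases Nat.lt_or_ge (t + j) p with htj | htj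
    · exact hleft (by omega) hy (h.descProd_mul_of_lt t j htj)
    rcases Nat.eq_or_lt_of_le htj with htj | htj
    · obtain rfl : t = p - j := by omega
      exact hmem hx (descProd_mem (j := j + 1) (by omega))
    rcases Nat.eq_or_lt_of_le (Nat.succ_le_of_lt htj) with htj | htj
    · obtain ⟨i, rfl⟩ : ∃ i, j = i + 1 := ⟨j - 1, by omega⟩
      obtain rfl : t = p - i := by omega
      exact hquad ht (descProd_mem (by omega)) hy
    · obtain ⟨s, rfl⟩ : ∃ s, t = s + 1 := ⟨t - 1, by omega⟩
      by_cases hs : 1 ≤ s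
      · exact hleft (by omega) hy
          (h.descProd_mul_of_gt s j hs (by omega) (by omega) (by omega))
      · obtain rfl : s = 0 := by omega
        obtain rfl : j = p + 1 := by omega
        exact hmem hx (ascProd_mem (k := 1) (by omega))
  · obtain ⟨k, hk, rfl⟩ := Finset.mem_image.1 hy'
    rw [Finset.mem_range] at hk
    exact hasc (k + 1) (by omega) rfl (by omega)

/-- Multiplying the set for p generators by the 2(p + 1) coset products gives the set for p + 1.
Coincidences among the products do no harm, since only an upper bound is needed. -/
theorem IsHeckeFamily.exists_finset (d : ℕ) (h : IsHeckeFamily K T d) :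
    ∃ B : Finset A, B.card ≤ 2 ^ d * d.factorial ∧ 1 ∈ Submodule.span K (B : Set A) ∧
      ∀ t < d, ∀ x ∈ Submodule.span K (B : Set A), x * T t ∈ Submodule.span K (B : Set A) := by
  classical
  induction d with
  | zero => exact ⟨{1}, by simp, Submodule.subset_span (by simp), fun t ht => by omega⟩
  | succ p ih =>
    obtain ⟨B, hB, h1, hN⟩ := ih (h.mono (by omega))
    refine ⟨B * cosetProds T p, ?_, ?_, ?_⟩
    · calc (B * cosetProds T p).card ≤ B.card * (cosetProds T p).card := Finset.card_mul_le
        _ ≤ (2 ^ p * p.factorial) * (2 * (p + 1)) := Nat.mul_le_mul hB (card_cosetProds_le T p)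
        _ = 2 ^ (p + 1) * (p + 1).factorial := by rw [Nat.factorial_succ]; ring
    · rw [Finset.coe_mul, ← Submodule.span_mul_span, ← mul_one (1 : A)]
      exact Submodule.mul_mem_mul h1 (Submodule.subset_span (descProd_mem (j := 0) (by omega)))
    · intro t ht x hx
      rw [Finset.coe_mul, ← Submodule.span_mul_span] at hx ⊢
      induction hx using Submodule.mul_induction_on' with
      | mem_mul_mem x hx y hy =>
        induction hy using Submodule.span_induction with
        | mem y hy => rw [mul_assoc]; exact h.mem_mul_span_cosetProds _ hN hx hy ht
        | zero => simp
        | add y z _ _ hy hz => rw [mul_add, add_mul]; exact add_mem hy hz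
        | smul c y _ hy =>
          rw [mul_smul_comm, smul_mul_assoc]; exact Submodule.smul_mem _ _ hy
      | add x _ y _ hx hy => rw [add_mul]; exact add_mem hx hy

end Spanning

/-! ### Dimension and anti-automorphism of the Hecke algebra. -/

section HeckeRank

variable {K : Type u} [Field K] (Q q : Kˣ) {d : ℕ}

theorem HeckeB.adjoin_T : Algebra.adjoin K (Set.range (HeckeB.T Q q (d := d))) = ⊤ := by
  have hs : Function.Surjective (RingQuot.mkAlgHom K (HeckeRel Q q d)) :=
    RingQuot.mkAlgHom_surjective K _
  have h := congrArg (Subalgebra.map (RingQuot.mkAlgHom K (HeckeRel Q q d)))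
    (FreeAlgebra.adjoin_range_ι K (Fin d))
  rw [AlgHom.map_adjoin, ← Set.range_comp, Algebra.map_top, (AlgHom.range_eq_top _).2 hs] at h
  exact h

theorem HeckeB.induction {P : HeckeB Q q d → Prop} (hT : ∀ t, P (HeckeB.T Q q t))
    (hK : ∀ c : K, P (algebraMap K _ c)) (hadd : ∀ x y, P x → P y → P (x + y))
    (hmul : ∀ x y, P x → P y → P (x * y)) (x : HeckeB Q q d) : P x := by
  have hx : x ∈ Algebra.adjoin K (Set.range (HeckeB.T Q q (d := d))) := by
    rw [HeckeB.adjoin_T]; trivial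
  induction hx using Algebra.adjoin_induction with
  | mem x hx => obtain ⟨t, rfl⟩ := hx; exact hT t
  | algebraMap c => exact hK c
  | add x y _ _ hx hy => exact hadd x y hx hy
  | mul x y _ _ hx hy => exact hmul x y hx hy

theorem HeckeB.T_braid (i j : Fin d) (hi : 1 ≤ i.val) (hj : j.val = i.val + 1) :
    T Q q i * T Q q j * T Q q i = T Q q j * T Q q i * T Q q j := by
  have h := RingQuot.mkAlgHom_rel K (HeckeRel.braid (Q := Q) (q := q) i j hi hj)
  simp only [map_mul] at h
  exact h

theorem HeckeB.T_braid_zero (i j : Fin d) (hi : i.val = 0) (hj : j.val = 1) :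
    (T Q q i * T Q q j) ^ 2 = (T Q q j * T Q q i) ^ 2 := by
  have h := RingQuot.mkAlgHom_rel K (HeckeRel.braid_zero (Q := Q) (q := q) i j hi hj)
  simp only [map_mul, map_pow] at h
  exact h

theorem HeckeB.T_comm (i j : Fin d) (hij : i.val + 1 < j.val) :
    T Q q i * T Q q j = T Q q j * T Q q i := by
  have h := RingQuot.mkAlgHom_rel K (HeckeRel.comm (Q := Q) (q := q) i j hij)
  simp only [map_mul] at h
  exact h

/-- The parameter `c` in the quadratic relation `T_t ^ 2 = c T_t + 1`. -/
def quadCoeff (t : Fin d) : K := if t.val = 0 then (↑Q⁻¹ : K) - (Q : K) else (↑q⁻¹ : K) - (q : K)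

theorem HeckeB.T_quad (i : Fin d) : T Q q i ^ 2 = quadCoeff Q q i • T Q q i + 1 := by
  rw [quadCoeff]
  split_ifs with hi
  · have h := RingQuot.mkAlgHom_rel K (HeckeRel.quad_zero (Q := Q) (q := q) i hi)
    simp only [map_add, map_smul, map_one, map_pow] at h
    exact h
  · have h := RingQuot.mkAlgHom_rel K (HeckeRel.quad (Q := Q) (q := q) i (by omega))
    simp only [map_add, map_smul, map_one, map_pow] at h
    exact h

theorem HeckeB.isHeckeFamily :
    IsHeckeFamily K (fun i => if h : i < d then T Q q (⟨i, h⟩ : Fin d) else 0) d where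
  comm i j hij hj := by
    simp only [hj, show i < d by omega, dif_pos]
    exact T_comm Q q ⟨i, by omega⟩ ⟨j, hj⟩ hij
  braid i hi hj := by
    simp only [hj, show i < d by omega, dif_pos]
    exact T_braid Q q ⟨i, by omega⟩ ⟨i + 1, hj⟩ hi rfl
  braid_zero hd := by
    simp only [hd, show 0 < d by omega, dif_pos]
    simpa only [pow_two, mul_assoc] using T_braid_zero Q q ⟨0, by omega⟩ ⟨1, hd⟩ rfl rfl
  quad i hi := by
    simp only [hi, dif_pos]
    exact ⟨_, by rw [← pow_two]; exact T_quad Q q ⟨i, hi⟩⟩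

theorem HeckeB.exists_span_eq_top :
    ∃ B : Finset (HeckeB Q q d), B.card ≤ 2 ^ d * d.factorial ∧
      Submodule.span K (B : Set (HeckeB Q q d)) = ⊤ := by
  obtain ⟨B, hB, h1, hN⟩ := (HeckeB.isHeckeFamily Q q (d := d)).exists_finset
  refine ⟨B, hB, Submodule.eq_top_iff'.2 fun x => ?_⟩
  -- Stability of the span under right multiplication by `x`, unlike membership of `x`, passes to
  -- products.
  suffices ∀ y ∈ Submodule.span K (B : Set (HeckeB Q q d)),
      y * x ∈ Submodule.span K (B : Set (HeckeB Q q d)) by simpa using this 1 h1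
  induction x using HeckeB.induction with
  | hT t => intro y hy; simpa using hN t t.2 y hy
  | hK c =>
    intro y hy
    rw [← Algebra.commutes, ← Algebra.smul_def]
    exact Submodule.smul_mem _ _ hy
  | hadd x z hx hz => intro y hy; rw [mul_add]; exact add_mem (hx y hy) (hz y hy)
  | hmul x z hx hz => intro y hy; rw [← mul_assoc]; exact hz _ (hx y hy)

theorem HeckeB.finite : Module.Finite K (HeckeB Q q d) := by
  obtain ⟨B, -, hB⟩ := HeckeB.exists_span_eq_top Q q (d := d)
  exact ⟨⟨B, hB⟩⟩

theorem HeckeB.finrank_le : Module.finrank K (HeckeB Q q d) ≤ 2 ^ d * d.factorial := by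
  obtain ⟨B, hc, hB⟩ := HeckeB.exists_span_eq_top Q q (d := d)
  have := finrank_span_finset_le_card (R := K) B
  rw [Set.finrank, hB, finrank_top] at this
  exact this.trans hc

/-- The anti-automorphism of the Hecke algebra that fixes the generators, as a homomorphism to the
opposite algebra. -/
noncomputable def HeckeB.antiHom (d : ℕ) : HeckeB Q q d →ₐ[K] (HeckeB Q q d)ᵐᵒᵖ :=
  RingQuot.liftAlgHom K
    ⟨FreeAlgebra.lift K (fun t : Fin d => op (HeckeB.T Q q t)), by
      -- Reversing words preserves every relation: it fixes both sides of the braid relations of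
      -- length three and of the quadratic relations, and exchanges the two sides of the others.
      intro x y h
      cases h with
      | braid i j hi hj =>
        simp only [map_mul, FreeAlgebra.lift_ι_apply, ← op_mul, ← mul_assoc]
        rw [HeckeB.T_braid Q q i j hi hj]
      | braid_zero i j hi hj =>
        simp only [map_mul, map_pow, FreeAlgebra.lift_ι_apply, ← op_mul, ← op_pow]
        rw [HeckeB.T_braid_zero Q q i j hi hj]
      | comm i j hij =>
        simp only [map_mul, FreeAlgebra.lift_ι_apply, ← op_mul]
        rw [HeckeB.T_comm Q q i j hij]
      | quad_zero i hi =>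
        simp only [map_add, map_smul, map_one, map_pow, FreeAlgebra.lift_ι_apply, ← op_pow]
        rw [HeckeB.T_quad, quadCoeff, if_pos hi, op_add, op_smul, op_one]
      | quad i hi =>
        simp only [map_add, map_smul, map_one, map_pow, FreeAlgebra.lift_ι_apply, ← op_pow]
        rw [HeckeB.T_quad, quadCoeff, if_neg (by omega), op_add, op_smul, op_one]⟩

theorem HeckeB.antiHom_T (t : Fin d) : antiHom Q q d (T Q q t) = op (T Q q t) := by
  rw [antiHom, T]
  erw [RingQuot.liftAlgHom_mkAlgHom_apply]
  rw [FreeAlgebra.lift_ι_apply]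
  rfl

theorem HeckeB.antiHom_antiHom (x : HeckeB Q q d) :
    (antiHom Q q d (antiHom Q q d x).unop).unop = x := by
  induction x using HeckeB.induction with
  | hT t => simp [antiHom_T]
  | hK c => simp [AlgHom.commutes, MulOpposite.algebraMap_apply]
  | hadd x y hx hy => simp [hx, hy]
  | hmul x y hx hy => simp [hx, hy]

/-- The anti-automorphism of the Hecke algebra that fixes the generators. -/
noncomputable def HeckeB.anti (d : ℕ) : HeckeB Q q d ≃ₐ[K] (HeckeB Q q d)ᵐᵒᵖ :=
  AlgEquiv.ofBijective (antiHom Q q d)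
    ⟨fun x y h => by rw [← antiHom_antiHom Q q x, h, antiHom_antiHom],
      fun y => ⟨(antiHom Q q d y.unop).unop, unop_injective (antiHom_antiHom Q q y.unop)⟩⟩

theorem HeckeB.anti_T (t : Fin d) : anti Q q d (T Q q t) = op (T Q q t) := antiHom_T Q q t

end HeckeRank

/-! ### Combinatorics of signed permutations: reflections and descents. -/

/-- Signed permutations of `1, …, d`: the pair `(π, ε)` sends `i` to `ε_i π(i)`. -/
abbrev SignedPerm (d : ℕ) : Type := Equiv.Perm (Fin d) × (Fin d → ℤˣ)

namespace SignedPerm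

variable {d : ℕ}

/-- The `i`-th entry of a signed permutation. -/
def val (w : SignedPerm d) (i : Fin d) : ℤ := (w.2 i : ℤ) * ((w.1 i : ℕ) + 1)

/-- The inverse signed permutation. -/
def inv (w : SignedPerm d) : SignedPerm d := (w.1.symm, w.2 ∘ w.1.symm)

/-- Right multiplication by the simple reflection `s_u`. -/
def right (u : Fin d) (w : SignedPerm d) : SignedPerm d :=
  if u.val = 0 then (w.1, Function.update w.2 u (-w.2 u))
  else (w.1 * Equiv.swap (prevPos u) u, w.2 ∘ Equiv.swap (prevPos u) u)

/-- Left multiplication by the simple reflection `s_t`. -/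
def left (t : Fin d) (w : SignedPerm d) : SignedPerm d :=
  if t.val = 0 then (w.1, Function.update w.2 (w.1.symm t) (-w.2 (w.1.symm t)))
  else (Equiv.swap (prevPos t) t * w.1, w.2)

/-- The simple reflection `s_u` is a right descent. -/
def Desc (u : Fin d) (w : SignedPerm d) : Prop :=
  if u.val = 0 then val w u < 0 else val w u < val w (prevPos u)

theorem prevPos_ne {u : Fin d} (hu : u.val ≠ 0) : prevPos u ≠ u := fun h => by
  have := congrArg Fin.val h
  simp only [prevPos] at this
  omega

/-- Left multiplication acts on values; in this form comparisons of entries become linear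
arithmetic. -/
theorem val_swap (t x : Fin d) : ((Equiv.swap (prevPos t) t x : Fin d) : ℕ) =
    if x.val = t.val - 1 then t.val else if x.val = t.val then t.val - 1 else x.val := by
  simp only [Equiv.swap_apply_def, Fin.ext_iff, prevPos]
  split_ifs <;> simp_all

theorem inv_inv (w : SignedPerm d) : inv (inv w) = w := by
  refine Prod.ext (Equiv.symm_symm _) ?_
  funext i
  simp [inv]

theorem right_right (u : Fin d) (w : SignedPerm d) : right u (right u w) = w := by
  unfold right
  split_ifs with h
  · simp
  · refine Prod.ext ?_ ?_
    · simp [mul_assoc]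
    · funext i; simp

/-- Inversion exchanges the two multiplications, which transfers statements about right descents to
left descents; the latter are expressed as `Desc t (inv w)`. -/
theorem left_eq (t : Fin d) (w : SignedPerm d) : left t w = inv (right t (inv w)) := by
  unfold left right inv
  split_ifs with h
  · refine Prod.ext (Equiv.symm_symm _).symm ?_
    funext i
    by_cases hi : i = w.1.symm t
    · subst hi; simp
    · have : w.1 i ≠ t := fun h => hi (by rw [← h]; simp)
      simp [Function.update_of_ne hi, this]
  · refine Prod.ext (by simp [← Equiv.Perm.inv_def, mul_inv_rev]) ?_
    funext i
    simp [← Equiv.Perm.inv_def, mul_inv_rev]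
    exact congrArg w.2 (w.1.symm_apply_apply i).symm

theorem left_left (t : Fin d) (w : SignedPerm d) : left t (left t w) = w := by
  rw [left_eq, left_eq, inv_inv, right_right, inv_inv]

theorem left_right (t u : Fin d) (w : SignedPerm d) : left t (right u w) = right u (left t w) := by
  unfold left right
  split_ifs with ht hu hu
  · obtain rfl : t = u := Fin.ext (by omega)
    refine Prod.ext rfl ?_
    dsimp only
    by_cases h : w.1.symm t = t
    · rw [h]
    · rw [Function.update_comm h]
      simp [Function.update_of_ne h, Function.update_of_ne (Ne.symm h)]
  · refine Prod.ext rfl ?_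
    funext i
    have h2 : (w.1 * Equiv.swap (prevPos u) u).symm t = Equiv.swap (prevPos u) u (w.1.symm t) := by
      simp [← Equiv.Perm.inv_def, mul_inv_rev]
    simp only [h2, Function.comp_apply]
    by_cases hi : Equiv.swap (prevPos u) u i = w.1.symm t
    · have : i = Equiv.swap (prevPos u) u (w.1.symm t) := by rw [← hi]; simp
      subst this
      simp
    · have : i ≠ Equiv.swap (prevPos u) u (w.1.symm t) := fun h => hi (by rw [h]; simp)
      rw [Function.update_of_ne this, Function.update_of_ne hi, Function.comp_apply]
  · rfl
  · exact Prod.ext (mul_assoc _ _ _).symm rfl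

theorem val_right (u : Fin d) (w : SignedPerm d) (i : Fin d) :
    val (right u w) i = if u.val = 0 then (if i = u then -val w i else val w i)
      else val w (Equiv.swap (prevPos u) u i) := by
  unfold right val
  split_ifs with h1 h2
  · subst h2; simp
  · simp [Function.update_of_ne h2]
  · simp

theorem val_pos_or_neg (w : SignedPerm d) (i : Fin d) : 0 < val w i ∨ val w i < 0 := by
  unfold val
  rcases Int.units_eq_one_or (w.2 i) with h | h
  · left; rw [h]; push_cast; omega
  · right; rw [h]; push_cast; omega

theorem natAbs_val (w : SignedPerm d) (i : Fin d) : (val w i).natAbs = w.1 i + 1 := by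
  unfold val
  rcases Int.units_eq_one_or (w.2 i) with h | h <;> rw [h] <;> push_cast <;> omega

theorem val_ne_val (w : SignedPerm d) {i j : Fin d} (hij : i ≠ j) : val w i ≠ val w j := fun h => by
  have h' := congrArg Int.natAbs h
  rw [natAbs_val, natAbs_val] at h'
  exact hij (w.1.injective (Fin.ext (by omega)))

theorem ext_val {w x : SignedPerm d} (h : ∀ i, val w i = val x i) : w = x := by
  have h1 : w.1 = x.1 := Equiv.ext fun i => by
    have := congrArg Int.natAbs (h i)
    rw [natAbs_val, natAbs_val] at this
    exact Fin.ext (by omega)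
  refine Prod.ext h1 (funext fun i => Units.ext ?_)
  have := h i
  unfold val at this
  rw [h1] at this
  exact mul_right_cancel₀ (by positivity) this

theorem desc_right (u : Fin d) (w : SignedPerm d) : Desc u (right u w) ↔ ¬ Desc u w := by
  unfold Desc
  split_ifs with h
  · rw [val_right, if_pos h, if_pos rfl]
    rcases val_pos_or_neg w u with h | h <;> omega
  · simp only [val_right, if_neg h, Equiv.swap_apply_right, Equiv.swap_apply_left]
    have := val_ne_val w (prevPos_ne h)
    omega

/-- In terms of roots: u is a descent of w when w(α_u) is negative, and s_t changes the sign of no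
root except ±α_t. So the status can change only if w(α_u) = ±α_t, which means s_t w = w s_u. -/
theorem desc_left {t u : Fin d} {w : SignedPerm d} (h : left t w ≠ right u w) :
    Desc u (left t w) ↔ Desc u w := by
  unfold Desc
  by_cases hu : u.val = 0
  · rw [if_pos hu, if_pos hu]
    by_cases ht : t.val = 0
    · obtain rfl : t = u := Fin.ext (by omega)
      have hne : t ≠ w.1.symm t := fun h' => h (by
        rw [left, right, if_pos ht, if_pos ht, ← h'])
      simp [left, ht, val, Function.update_of_ne hne]
    · simp only [left, ht, val, if_false]
      rcases Int.units_eq_one_or (w.2 u) with h | h <;> rw [h] <;> push_cast <;> omega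
  · rw [if_neg hu, if_neg hu]
    have hπ : (w.1 (prevPos u)).val ≠ (w.1 u).val := fun h' =>
      prevPos_ne hu (w.1.injective (Fin.ext h'))
    by_cases ht : t.val = 0
    · have hval : ∀ i, val (left t w) i =
          if (w.1 i).val = 0 then - val w i else val w i := fun i => by
        simp only [left, ht, if_true, val]
        split_ifs with hi
        · have : i = w.1.symm t := by rw [← Fin.ext (hi.trans ht.symm)]; simp
          rw [← this]; simp
        · have : i ≠ w.1.symm t := fun h' => hi (by rw [h']; simpa using ht)
          rw [Function.update_of_ne this]
      rw [hval, hval]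
      unfold val
      rcases Int.units_eq_one_or (w.2 u) with h1 | h1 <;>
        rcases Int.units_eq_one_or (w.2 (prevPos u)) with h2 | h2 <;>
        rw [h1, h2] <;> push_cast <;> split_ifs <;> omega
    · have hval : ∀ i, val (left t w) i = (w.2 i : ℤ) *
          (((if (w.1 i).val = t.val - 1 then t.val else if (w.1 i).val = t.val then t.val - 1
            else (w.1 i).val : ℕ) : ℤ) + 1) := fun i => by
        simp only [left, ht, if_false, val, Equiv.Perm.mul_apply, val_swap]
      -- Exchanging two neighbouring absolute values reverses the order of two entries only if the
      -- entries have exactly these absolute values and the same sign; in that case s_t w = w s_u.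
      have hex : w.2 u = w.2 (prevPos u) →
          ¬ ((w.1 (prevPos u) = prevPos t ∧ w.1 u = t) ∨
            (w.1 (prevPos u) = t ∧ w.1 u = prevPos t)) := by
        intro he hp
        apply h
        have hs : Equiv.swap (prevPos t) t =
            Equiv.swap (w.1 (prevPos u)) (w.1 u) := by
          rcases hp with ⟨h1, h2⟩ | ⟨h1, h2⟩
          · rw [h1, h2]
          · rw [h1, h2, Equiv.swap_comm]
        rw [left, right, if_neg ht, if_neg hu, hs, comp_swap_of_eq _ _ _ he.symm]
        refine Prod.ext ?_ rfl
        exact (Equiv.mul_swap_eq_swap_mul _ _ _).symm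
      have hpt : (prevPos t).val = t.val - 1 := rfl
      simp only [Fin.ext_iff, hpt] at hex
      rw [hval, hval]
      unfold val
      generalize (w.1 u).val = a at *
      generalize (w.1 (prevPos u)).val = b at *
      have key : ∀ x : ℕ, (x = t.val - 1 ∧ (if x = t.val - 1 then t.val else
          if x = t.val then t.val - 1 else x) = t.val) ∨
          (x = t.val ∧ (if x = t.val - 1 then t.val else
          if x = t.val then t.val - 1 else x) = t.val - 1) ∨
          (x ≠ t.val - 1 ∧ x ≠ t.val ∧ (if x = t.val - 1 then t.val else
          if x = t.val then t.val - 1 else x) = x) := fun x => by split_ifs <;> omega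
      have ka := key a
      have kb := key b
      generalize (if a = t.val - 1 then t.val else if a = t.val then t.val - 1 else a) = a' at *
      generalize (if b = t.val - 1 then t.val else if b = t.val then t.val - 1 else b) = b' at *
      rcases Int.units_eq_one_or (w.2 u) with h1 | h1 <;>
        rcases Int.units_eq_one_or (w.2 (prevPos u)) with h2 | h2 <;>
        rw [h1, h2] at hex ⊢ <;> push_cast <;> first | omega | (have := hex rfl; omega)

/-- Only s_0 has a trivial underlying permutation. This makes the Hecke parameters of t and u agree
when s_t and s_u are conjugate through w. -/
theorem zero_iff_of_left_eq_right {t u : Fin d} {w : SignedPerm d}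
    (h : left t w = right u w) : t.val = 0 ↔ u.val = 0 := by
  have h1 := congrArg Prod.fst h
  unfold left right at h1
  split_ifs at h1 with ht hu hu
  · simp [ht, hu]
  · exact absurd (Equiv.swap_eq_one_iff.1 (mul_eq_left.1 h1.symm)) (prevPos_ne hu)
  · exact absurd (Equiv.swap_eq_one_iff.1 (mul_eq_right.1 h1)) (prevPos_ne ht)
  · simp [ht, hu]

/-- Both sides say that the one element s_t w = w s_u is shorter than w; the proof compares entries
instead of lengths. -/
theorem desc_iff_of_left_eq_right {t u : Fin d} {w : SignedPerm d}
    (h : left t w = right u w) : Desc u w ↔ Desc t (inv w) := by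
  have htu := zero_iff_of_left_eq_right h
  by_cases hu : u.val = 0
  · have ht := htu.2 hu
    obtain rfl : t = u := Fin.ext (by omega)
    have h2 := congrArg Prod.snd h
    simp only [left, right, hu, if_true] at h2
    have hfix : t = w.1.symm t := by
      by_contra hne
      have h3 := congrFun h2 t
      rw [Function.update_of_ne hne, Function.update_self] at h3
      rcases Int.units_eq_one_or (w.2 t) with h | h <;> rw [h] at h3 <;> exact absurd h3 (by decide)
    have hfix' : w.1 t = t := by conv_lhs => rw [hfix]; simp
    simp only [Desc, hu, if_true, val, inv, Function.comp_apply, ← hfix, hfix']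
  · have ht : t.val ≠ 0 := fun h => hu (htu.1 h)
    simp only [left, right, if_neg hu, if_neg ht, Prod.mk.injEq] at h
    obtain ⟨h1, h2⟩ := h
    have he : w.2 u = w.2 (prevPos u) := by
      have := congrFun h2 u; simpa using this
    rw [Equiv.mul_swap_eq_swap_mul, mul_left_inj] at h1
    have hp : (w.1 (prevPos u) = prevPos t ∧ w.1 u = t) ∨
        (w.1 (prevPos u) = t ∧ w.1 u = prevPos t) := by
      have hne := prevPos_ne ht
      have ha := congrArg (fun σ => σ t) h1
      have hb := congrArg (fun σ => σ (prevPos t)) h1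
      simp only [Equiv.swap_apply_right, Equiv.swap_apply_left, Equiv.swap_apply_def] at ha hb
      grind
    simp only [Desc, hu, ht, if_false, val, inv, Function.comp_apply]
    rcases hp with ⟨ha, hb⟩ | ⟨ha, hb⟩
    · have ha' : w.1.symm (prevPos t) = prevPos u := by rw [← ha]; simp
      have hb' : w.1.symm t = u := by conv_lhs => rw [← hb]; simp
      rw [ha', hb', ha, hb, he]
      simp only [prevPos]
      rcases Int.units_eq_one_or (w.2 (prevPos u)) with h | h <;> simp only [prevPos] at h <;>
        rw [h] <;> push_cast <;> omega
    · have ha' : w.1.symm t = prevPos u := by rw [← ha]; simp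
      have hb' : w.1.symm (prevPos t) = u := by rw [← hb]; simp
      rw [ha', hb', ha, hb, he]
      simp only [prevPos]
      rcases Int.units_eq_one_or (w.2 (prevPos u)) with h | h <;> simp only [prevPos] at h <;>
        rw [h] <;> push_cast <;> omega

theorem desc_inv_right {t u : Fin d} {w : SignedPerm d} (h : left t w ≠ right u w) :
    Desc t (inv (right u w)) ↔ Desc t (inv w) := by
  have h1 : inv (right u w) = left u (inv w) := by rw [left_eq, inv_inv]
  rw [h1]
  refine desc_left fun h2 => h ?_
  rw [left_eq, ← h2, left_eq, inv_inv, inv_inv]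

theorem desc_inv_left (t : Fin d) (w : SignedPerm d) :
    Desc t (inv (left t w)) ↔ ¬ Desc t (inv w) := by
  rw [left_eq, inv_inv, desc_right]

/-- The identity. -/
protected def one (d : ℕ) : SignedPerm d := (1, 1)

theorem val_one (i : Fin d) : val (SignedPerm.one d) i = i.val + 1 := by simp [val, SignedPerm.one]

theorem not_desc_one (u : Fin d) : ¬ Desc u (SignedPerm.one d) := by
  unfold Desc
  split_ifs with h
  · rw [val_one]; omega
  · rw [val_one, val_one]; simp only [prevPos]; omega

theorem inv_one : inv (SignedPerm.one d) = SignedPerm.one d := by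
  simp [inv, SignedPerm.one, ← Equiv.Perm.inv_def]

theorem left_one (t : Fin d) : left t (SignedPerm.one d) = right t (SignedPerm.one d) := by
  unfold left right SignedPerm.one
  split_ifs with h
  · rfl
  · exact Prod.ext rfl rfl

/-- Without descents the entries are positive and increasing, so each is at least its position
counted from 1. The absolute values have the same sum as the positions, which forces equality. -/
theorem eq_one_of_not_desc (w : SignedPerm d) (h : ∀ u, ¬ Desc u w) : w = SignedPerm.one d := by
  have hge : ∀ k (hk : k < d), (k : ℤ) + 1 ≤ val w ⟨k, hk⟩ := by
    intro k
    induction k with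
    | zero =>
      intro hk
      have := h ⟨0, hk⟩
      simp only [Desc, if_true] at this
      have := val_pos_or_neg w ⟨0, hk⟩
      push_cast
      omega
    | succ k ih =>
      intro hk
      have h1 := h ⟨k + 1, hk⟩
      have h2 := ih (by omega)
      simp only [Desc, prevPos, Nat.add_sub_cancel, Nat.succ_ne_zero, if_false] at h1
      have h3 := val_ne_val w (i := ⟨k, by omega⟩) (j := ⟨k + 1, hk⟩) (by simp)
      push_cast
      omega
  have hle : ∀ i ∈ Finset.univ, (i : Fin d).val ≤ (w.1 i).val := fun i _ => by
    have h1 := hge i i.2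
    have h2 := natAbs_val w i
    simp only [Fin.eta] at h1
    omega
  have heq := (Finset.sum_eq_sum_iff_of_le hle).1
    (Equiv.sum_comp w.1 (fun i : Fin d => i.val)).symm
  refine ext_val fun i => ?_
  have h1 := hge i i.2
  have h2 := natAbs_val w i
  have h3 := heq i (Finset.mem_univ i)
  simp only [Fin.eta] at h1
  rw [val_one]
  omega

/-- A rearrangement inequality. This weighted sum replaces the length function: it grows whenever a
descent is removed. -/
theorem sum_lt_of_desc (u : Fin d) (w : SignedPerm d) (h : Desc u w) :
    ∑ i : Fin d, ((i.val : ℤ) + 1) * val w i <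
      ∑ i : Fin d, ((i.val : ℤ) + 1) * val (right u w) i := by
  unfold Desc at h
  split_ifs at h with hu
  · refine Finset.sum_lt_sum (fun i _ => ?_) ⟨u, Finset.mem_univ u, ?_⟩
    · rw [val_right, if_pos hu]
      split_ifs with hi
      · subst hi; nlinarith
      · exact le_rfl
    · rw [val_right, if_pos hu, if_pos rfl]; nlinarith
  -- Reindexing moves the transposition from the entries to the weights, so that only two summands
  -- change; the total changes by `val w (prevPos u) - val w u`.
  · have hsum : ∑ i : Fin d, ((i.val : ℤ) + 1) * val (right u w) i =
        ∑ i : Fin d, (((Equiv.swap (prevPos u) u i).val : ℤ) + 1) * val w i := by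
      rw [← Equiv.sum_comp (Equiv.swap (prevPos u) u)]
      simp [val_right, hu]
    rw [hsum, ← sub_pos, ← Finset.sum_sub_distrib,
      Fintype.sum_eq_add (prevPos u) u (prevPos_ne hu)]
    · simp only [Equiv.swap_apply_left, Equiv.swap_apply_right]
      have : ((prevPos u).val : ℤ) = u.val - 1 := by simp only [prevPos]; omega
      rw [this]
      linarith
    · rintro x ⟨h1, h2⟩
      rw [Equiv.swap_apply_of_ne_of_ne h1 h2, sub_self]

/-- Every signed permutation is reached from the identity by a chain of ascents. -/
theorem induction_ascent {P : SignedPerm d → Prop} (h1 : P (SignedPerm.one d))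
    (hs : ∀ u w, ¬ Desc u w → P w → P (right u w)) (w : SignedPerm d) : P w := by
  by_contra hw
  -- A counterexample with the largest weighted sum has a descent `u`; removing it gives an element
  -- satisfying `P`, from which `x` is regained by an ascent.
  obtain ⟨x, hx, hmax⟩ := Set.exists_max_image {w | ¬ P w}
    (fun w => ∑ i : Fin d, ((i.val : ℤ) + 1) * val w i) (Set.toFinite _) ⟨w, hw⟩
  obtain ⟨u, hu⟩ : ∃ u, Desc u x := by
    by_contra hn
    push Not at hn
    exact hx (eq_one_of_not_desc x hn ▸ h1)
  have hlt := sum_lt_of_desc u x hu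
  have hP : P (right u x) := by
    by_contra hP
    exact absurd (hmax _ hP) (not_le.2 hlt)
  have := hs u _ (fun h => (desc_right u x).1 h hu) hP
  rw [right_right] at this
  exact hx this

theorem card (d : ℕ) : Fintype.card (SignedPerm d) = 2 ^ d * d.factorial := by
  rw [Fintype.card_prod, Fintype.card_perm, Fintype.card_fun, Fintype.card_fin, mul_comm]
  rfl

end SignedPerm

/-! ### Formal consequences of a vector and a linear form with β(v₀) = 1. -/

section RankOne

variable {K H V : Type*} [Field K] [Ring H] [Algebra K H] [AddCommGroup V] [Module K V]
  [Module Hᵐᵒᵖ V] [SMulCommClass Hᵐᵒᵖ K V] [IsScalarTower K Hᵐᵒᵖ V]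

/-- The endomorphism `w ↦ v β(w)` of a right module, for a linear form `β`. -/
def rankOne (β : V →ₗ[Hᵐᵒᵖ] H) (v : V) : Module.End Hᵐᵒᵖ V where
  toFun w := op (β w) • v
  map_add' w w' := by rw [map_add, op_add, add_smul]
  map_smul' h w := by
    rw [map_smul, RingHom.id_apply, ← mul_smul]
    rfl

variable (β : V →ₗ[Hᵐᵒᵖ] H) (v₀ : V)

theorem rankOne_apply (v w : V) : rankOne β v w = op (β w) • v := rfl

/-- By H-linearity, s(vβ(w)) = (sv)β(w). This makes v ↦ vβ a map of left modules and underlies the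
whole section. -/
theorem mul_rankOne (s : Module.End Hᵐᵒᵖ V) (v : V) : s * rankOne β v = rankOne β (s v) := by
  ext w
  simp [rankOne_apply]

theorem rankOne_add (v w : V) : rankOne β (v + w) = rankOne β v + rankOne β w := by
  ext x
  simp [rankOne_apply]

variable {v₀}

theorem eq_rankOne_of_mul_base {s : Module.End Hᵐᵒᵖ V} (hs : s * rankOne β v₀ = s) :
    rankOne β (s v₀) = s := by
  rw [← mul_rankOne, hs]

variable (hβ : β v₀ = 1)
include hβ

theorem rankOne_apply_base (v : V) : rankOne β v v₀ = v := by
  rw [rankOne_apply, hβ, op_one, one_smul]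

theorem rankOne_mul_base (v : V) : rankOne β v * rankOne β v₀ = rankOne β v := by
  rw [mul_rankOne, rankOne_apply_base β hβ]

theorem isIdempotentElem_rankOne : IsIdempotentElem (rankOne β v₀) := rankOne_mul_base β hβ v₀

theorem base_mul_rankOne_smul (h : H) :
    rankOne β v₀ * rankOne β (op h • v₀) = rankOne β (op h • v₀) := by
  rw [mul_rankOne, map_smul, rankOne_apply_base β hβ]

/-- If `β(v₀) = 1` and `e` is the idempotent `w ↦ v₀ β(w)`, then the corner `e End(V) e` is
isomorphic to the algebra acting on `V`. -/
def cornerEquiv : (isIdempotentElem_rankOne β hβ).Corner ≃ₐ[K] H where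
  toFun f := β (f.1 v₀)
  invFun h := ⟨rankOne β (op h • v₀), (Subsemigroup.mem_corner_iff
    (isIdempotentElem_rankOne β hβ)).2 ⟨base_mul_rankOne_smul β hβ h, rankOne_mul_base β hβ _⟩⟩
  left_inv f := by
    obtain ⟨h1, h2⟩ := (Subsemigroup.mem_corner_iff (isIdempotentElem_rankOne β hβ)).1 f.2
    refine Subtype.ext ?_
    change rankOne β (rankOne β v₀ (f.1 v₀)) = f.1
    rw [← Module.End.mul_apply, h1, eq_rankOne_of_mul_base β h2]
  right_inv h := by
    change β (rankOne β (op h • v₀) v₀) = h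
    rw [rankOne_apply_base β hβ, map_smul, hβ, op_smul_eq_mul, one_mul]
  map_mul' f g := by
    obtain ⟨h1, -⟩ := (Subsemigroup.mem_corner_iff (isIdempotentElem_rankOne β hβ)).1 g.2
    change β (f.1 (g.1 v₀)) = β (f.1 v₀) * β (g.1 v₀)
    -- As eg = g, the vector g v₀ lies in v₀H; then `f` and β pull the scalar out on the right, so
    -- the order of the factors is kept.
    have h3 : g.1 v₀ = op (β (g.1 v₀)) • v₀ := by
      conv_lhs => rw [← h1]
      rfl
    conv_lhs => rw [h3, map_smul, map_smul]
    rfl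
  map_add' f g := by
    change β (f.1 v₀ + g.1 v₀) = _
    rw [map_add]
  commutes' c := by
    change β (c • rankOne β v₀ v₀) = _
    rw [rankOne_apply_base β hβ, LinearMap.map_smul_of_tower, hβ, Algebra.algebraMap_eq_smul_one]

theorem cornerEquiv_symm_apply (h : H) :
    ((cornerEquiv (K := K) β hβ).symm h).1 = rankOne β (op h • v₀) := rfl

/-- The isomorphism `v ↦ (w ↦ v β(w))` from `V` to the left ideal `End(V) e`. -/
def leftIdealEquiv : V ≃ₗ[Module.End Hᵐᵒᵖ V] Submodule.span (Module.End Hᵐᵒᵖ V) {rankOne β v₀} where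
  toFun v := ⟨rankOne β v, Submodule.mem_span_singleton.2 ⟨rankOne β v, rankOne_mul_base β hβ v⟩⟩
  invFun s := s.1 v₀
  left_inv v := rankOne_apply_base β hβ v
  right_inv s := by
    obtain ⟨x, hx⟩ := Submodule.mem_span_singleton.1 s.2
    refine Subtype.ext (eq_rankOne_of_mul_base β ?_)
    rw [← hx, smul_eq_mul, mul_assoc, (isIdempotentElem_rankOne β hβ).eq]
  map_add' v w := Subtype.ext (rankOne_add β v w)
  map_smul' s v := Subtype.ext (mul_rankOne β s v).symm

theorem leftIdealEquiv_smul (v : V) (h : H) :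
    (leftIdealEquiv β hβ (op h • v)).1 =
      (leftIdealEquiv β hβ v).1 * ((cornerEquiv (K := K) β hβ).symm h).1 := by
  rw [cornerEquiv_symm_apply]
  change rankOne β (op h • v) = rankOne β v * rankOne β (op h • v₀)
  rw [mul_rankOne, map_smul, rankOne_apply_base β hβ]

variable (τ : Module.End Hᵐᵒᵖ V ≃ₐ[K] (Module.End Hᵐᵒᵖ V)ᵐᵒᵖ)
  (hτ : τ (rankOne β v₀) = op (rankOne β v₀))

/-- The isomorphism from `V` to the right ideal `e End(V)` induced by an anti-automorphism of
`End(V)` that fixes `e`. -/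
def rightIdealEquiv : V ≃+ Submodule.span (Module.End Hᵐᵒᵖ V)ᵐᵒᵖ {rankOne β v₀} where
  toFun v := ⟨(τ (rankOne β v)).unop, Submodule.mem_span_singleton.2 ⟨τ (rankOne β v), by
    conv_rhs => rw [← rankOne_mul_base β hβ v, map_mul, hτ]
    rfl⟩⟩
  -- Because τ fixes e and reverses products, τ⁻¹ carries eS to Se, where an element is determined
  -- by its value at v₀.
  invFun s := τ.symm (op s.1) v₀
  left_inv v := by
    change τ.symm (op (unop (τ (rankOne β v)))) v₀ = v
    rw [op_unop, AlgEquiv.symm_apply_apply, rankOne_apply_base β hβ]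
  right_inv s := by
    obtain ⟨x, hx⟩ := Submodule.mem_span_singleton.1 s.2
    refine Subtype.ext ?_
    change (τ (rankOne β (τ.symm (op s.1) v₀))).unop = s.1
    rw [eq_rankOne_of_mul_base β, AlgEquiv.apply_symm_apply, unop_op]
    apply τ.injective
    rw [map_mul, AlgEquiv.apply_symm_apply, hτ, ← op_mul, ← hx]
    congr 1
    change rankOne β v₀ * (rankOne β v₀ * x.unop) = rankOne β v₀ * x.unop
    rw [← mul_assoc, (isIdempotentElem_rankOne β hβ).eq]
  map_add' v w := Subtype.ext (by
    change (τ (rankOne β (v + w))).unop = (τ (rankOne β v)).unop + (τ (rankOne β w)).unop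
    rw [rankOne_add, map_add, unop_add])

theorem rightIdealEquiv_smul (s : Module.End Hᵐᵒᵖ V) (v : V) :
    (rightIdealEquiv β hβ τ hτ (s • v)).1 = (rightIdealEquiv β hβ τ hτ v).1 * (τ s).unop := by
  change (τ (rankOne β (s v))).unop = (τ (rankOne β v)).unop * (τ s).unop
  rw [← mul_rankOne, map_mul, unop_mul]

theorem rightIdealEquiv_op_smul (v : V) (h : H) :
    (rightIdealEquiv β hβ τ hτ (op h • v)).1 =
      (τ (rankOne β (op h • v₀))).unop * (rightIdealEquiv β hβ τ hτ v).1 := by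
  change (τ (rankOne β (op h • v))).unop = _ * (τ (rankOne β v)).unop
  rw [← unop_mul, ← map_mul, mul_rankOne, map_smul, rankOne_apply_base β hβ]

end RankOne

/-! ### The functor M ↦ eM for an idempotent. -/

section SchurFunctor

open CategoryTheory

variable {A H : Type*} [Ring A] [Ring H] {e : A} (he : IsIdempotentElem e) (φ : H →+* he.Corner)

include he in
theorem mem_idemPart_iff {M : Type*} [AddCommGroup M] [Module A M] {x : M} :
    x ∈ idemPart e M ↔ e • x = x := by
  constructor
  · rintro ⟨y, rfl⟩
    change e • e • y = e • y
    rw [← mul_smul, he.eq]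
  · exact fun h => ⟨x, h⟩

/-- The module structure on `e M` over a ring that maps to the corner `e A e`. -/
abbrev idemPartModule (M : Type*) [AddCommGroup M] [Module A M] : Module H (idemPart e M) where
  smul h x := ⟨(φ h).1 • x.1, by
    rw [mem_idemPart_iff he, ← mul_smul,
      ((Subsemigroup.mem_corner_iff he).1 (φ h).2).1]⟩
  one_smul x := Subtype.ext (by
    change (φ 1).1 • x.1 = x.1
    rw [map_one]
    exact (mem_idemPart_iff he).1 x.2)
  mul_smul h k x := Subtype.ext (by
    change (φ (h * k)).1 • x.1 = (φ h).1 • (φ k).1 • x.1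
    rw [map_mul, ← mul_smul]
    rfl)
  smul_zero h := Subtype.ext (smul_zero (φ h).1)
  smul_add h x y := Subtype.ext (smul_add (φ h).1 x.1 y.1)
  add_smul h k x := Subtype.ext (by
    change (φ (h + k)).1 • x.1 = (φ h).1 • x.1 + (φ k).1 • x.1
    rw [map_add, ← add_smul]
    rfl)
  zero_smul x := Subtype.ext (by
    change (φ 0).1 • x.1 = 0
    rw [map_zero]
    exact zero_smul A x.1)

/-- The functor `M ↦ e M` from `A`-modules to modules over a ring that maps to `e A e`. -/
def idemFunctor : ModuleCat.{w} A ⥤ ModuleCat.{w} H where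
  obj M := letI := idemPartModule he φ M; ModuleCat.of H (idemPart e M)
  map {M N} f := letI := idemPartModule he φ M; letI := idemPartModule he φ N
    ModuleCat.ofHom
      { toFun := fun x => ⟨f.hom x.1, by
          rw [mem_idemPart_iff he, ← map_smul, (mem_idemPart_iff he).1 x.2]⟩
        map_add' := fun x y => Subtype.ext (map_add f.hom x.1 y.1)
        map_smul' := fun h x => Subtype.ext (map_smul f.hom (φ h).1 x.1) }
  map_id M := rfl
  map_comp f g := rfl

theorem exists_idemFunctor :
    ∃ (F : ModuleCat.{w} A ⥤ ModuleCat.{w} H)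
      (η : ∀ M : ModuleCat.{w} A, F.obj M ≃+ idemPart e M),
      (∀ (M : ModuleCat.{w} A) (h : H) (x : F.obj M),
        (η M (h • x)).1 = (φ h).1 • (η M x).1) ∧
      (∀ (M N : ModuleCat.{w} A) (f : M ⟶ N) (x : F.obj M),
        (η N ((F.map f).hom x)).1 = f.hom (η M x).1) :=
  ⟨idemFunctor he φ, fun M => AddEquiv.refl (idemPart e M), fun _ _ _ => rfl, fun _ _ _ _ => rfl⟩

end SchurFunctor

/-! ### Transposition with respect to a basis. -/

section Transpose

variable {K V ι : Type*} [Field K] [AddCommGroup V] [Module K V] [Fintype ι] [DecidableEq ι]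
  (b : Module.Basis ι K V)

/-- The transpose of an endomorphism with respect to a basis. -/
noncomputable def transposeEnd (f : Module.End K V) : Module.End K V :=
  Matrix.toLin b b (LinearMap.toMatrix b b f).transpose

theorem repr_transposeEnd (f : Module.End K V) (i j : ι) :
    b.repr (transposeEnd b f (b i)) j = b.repr (f (b j)) i := by
  have h : LinearMap.toMatrix b b (transposeEnd b f) = (LinearMap.toMatrix b b f).transpose :=
    LinearMap.toMatrix_toLin b b _
  simpa [LinearMap.toMatrix_apply] using congrFun (congrFun h j) i

theorem transposeEnd_mul (f g : Module.End K V) :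
    transposeEnd b (f * g) = transposeEnd b g * transposeEnd b f := by
  unfold transposeEnd
  rw [LinearMap.toMatrix_mul, Matrix.transpose_mul, Matrix.toLin_mul b b b]
  rfl

theorem transposeEnd_transposeEnd (f : Module.End K V) :
    transposeEnd b (transposeEnd b f) = f := by
  unfold transposeEnd
  rw [LinearMap.toMatrix_toLin, Matrix.transpose_transpose, Matrix.toLin_toMatrix]

theorem transposeEnd_add (f g : Module.End K V) :
    transposeEnd b (f + g) = transposeEnd b f + transposeEnd b g := by
  simp [transposeEnd]

theorem transposeEnd_smul (c : K) (f : Module.End K V) :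
    transposeEnd b (c • f) = c • transposeEnd b f := by
  simp [transposeEnd]

theorem transposeEnd_one : transposeEnd b (1 : Module.End K V) = 1 := by
  simp [transposeEnd, Module.End.one_eq_id]

/-- A matrix supported on the diagonal and on the graph of an involution, along which its
coefficients are constant, is symmetric. -/
theorem transposeEnd_eq_self_of_involution (A : Module.End K V) (s : ι → ι) (a c : ι → K)
    (hs : ∀ i, s (s i) = i) (ha : ∀ i, a (s i) = a i)
    (hA : ∀ i, A (b i) = a i • b (s i) + c i • b i) : transposeEnd b A = A := by
  refine b.ext fun i => b.repr.injective (Finsupp.ext fun j => ?_)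
  rw [repr_transposeEnd, hA, hA]
  simp only [map_add, map_smul, Module.Basis.repr_self, Finsupp.add_apply, Finsupp.smul_apply,
    smul_eq_mul, Finsupp.single_apply]
  have h1 : s j = i ↔ s i = j := ⟨fun h => by rw [← h, hs], fun h => by rw [← h, hs]⟩
  congr 1
  · by_cases h : s i = j
    · rw [if_pos (h1.2 h), if_pos h, ← h, ha]
    · rw [if_neg (fun h' => h (h1.1 h')), if_neg h, mul_zero, mul_zero]
  · by_cases h : i = j
    · rw [h]
    · rw [if_neg h, if_neg (Ne.symm h), mul_zero, mul_zero]

end Transpose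

/-! ### Transposition on the Schur algebra. -/

section SchurTranspose

variable {K : Type u} [Field K] (Q q : Kˣ) {n d : ℕ}

theorem placeAct_placeAct (t : Fin d) (μ : Fin d → Idx n) : placeAct t (placeAct t μ) = μ := by
  unfold placeAct
  split_ifs with h
  · simp [Idx.neg_neg]
  · exact comp_swap_swap _ _ _

theorem op_T_smul_eq (t : Fin d) (v : TensorSpace K n d) :
    op (HeckeB.T Q q t) • v = genAct Q q n t v := by
  have h : (heckeAct Q q n d (HeckeB.T Q q t)).unop = genAct Q q n t :=
    (tensorBasis K n d).ext fun μ => by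
      rw [← op_smul_def, op_T_smul, genAct, Module.Basis.constr_basis]
  rw [op_smul_def, h]

/-- The coefficient of `v_{μ s_t}` in `v_μ T_t`. -/
noncomputable def swapCoeff (t : Fin d) (μ : Fin d → Idx n) : K :=
  if t.val = 0 then (if 0 = (μ t).1 then (↑Q⁻¹ : K) else 1)
  else (if μ (prevPos t) = μ t then (↑q⁻¹ : K) else 1)

/-- The coefficient of `v_μ` in `v_μ T_t`, for `μ ≠ μ s_t`. -/
noncomputable def diagCoeff (t : Fin d) (μ : Fin d → Idx n) : K :=
  if t.val = 0 then (if (μ t).1 < 0 then (↑Q⁻¹ : K) - (Q : K) else 0)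
  else (if μ t < μ (prevPos t) then (↑q⁻¹ : K) - (q : K) else 0)

theorem genAct_basis (t : Fin d) (μ : Fin d → Idx n) :
    genAct Q q n t (tensorBasis K n d μ) =
      swapCoeff Q q t μ • tensorBasis K n d (placeAct t μ) +
        diagCoeff Q q t μ • tensorBasis K n d μ := by
  rw [genAct, Module.Basis.constr_basis, basisAct, swapCoeff, diagCoeff]
  by_cases ht : t.val = 0
  · simp only [if_pos ht]
    rcases lt_trichotomy 0 (μ t).1 with h | h | h
    · rw [if_pos h, if_neg h.ne, if_neg h.asymm]; simp
    · rw [if_neg h.not_lt, if_pos h, if_pos h, if_neg h.symm.not_lt]; simp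
    · rw [if_neg h.asymm, if_neg h.ne', if_neg h.ne', if_pos h]; simp
  · simp only [if_neg ht]
    rcases lt_trichotomy (μ (prevPos t)) (μ t) with h | h | h
    · rw [if_pos h, if_neg h.ne, if_neg h.asymm]; simp
    · rw [if_neg h.not_lt, if_pos h, if_pos h, if_neg h.symm.not_lt]; simp
    · rw [if_neg h.asymm, if_neg h.ne', if_neg h.ne', if_pos h]; simp

theorem swapCoeff_placeAct (t : Fin d) (μ : Fin d → Idx n) :
    swapCoeff (K := K) Q q t (placeAct t μ) = swapCoeff Q q t μ := by
  unfold swapCoeff placeAct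
  by_cases ht : t.val = 0
  · have h : 0 = (μ t).neg.1 ↔ 0 = (μ t).1 := by simp only [Idx.neg]; omega
    simp only [if_pos ht, Function.update_self, h]
  · simp only [if_neg ht, Function.comp_apply, Equiv.swap_apply_left, Equiv.swap_apply_right,
      eq_comm]

/-- The off-diagonal coefficient is the same for μ and μ·s_t, so T_t has a symmetric matrix; this is
why the commutant of the generators is closed under transposition. -/
theorem transposeEnd_genAct (t : Fin d) :
    transposeEnd (tensorBasis K n d) (genAct Q q n t) = genAct Q q n t :=
  transposeEnd_eq_self_of_involution _ _ (placeAct t) (swapCoeff Q q t) (diagCoeff Q q t)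
    (placeAct_placeAct t) (swapCoeff_placeAct Q q t) (genAct_basis Q q t)

variable {Q q}

/-- A `K`-linear endomorphism of the tensor space that commutes with the generators of the Hecke
algebra is an element of the Schur algebra. -/
noncomputable def SchurB.ofCommute (f : Module.End K (TensorSpace K n d))
    (hf : ∀ t, f * genAct Q q n t = genAct Q q n t * f) : SchurB Q q n d where
  toFun := f
  map_add' := f.map_add
  map_smul' h v := by
    obtain ⟨h, rfl⟩ := op_surjective h
    rw [RingHom.id_apply]
    induction h using HeckeB.induction generalizing v with
    | hT t => rw [op_T_smul_eq, op_T_smul_eq]; exact LinearMap.congr_fun (hf t) v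
    | hK c =>
      have h : ∀ v : TensorSpace K n d, op (algebraMap K (HeckeB Q q d) c) • v = c • v := fun v => by
        rw [Algebra.algebraMap_eq_smul_one, op_smul, op_one, smul_assoc, one_smul]
      rw [h, h, f.map_smul]
    | hadd x y hx hy => rw [op_add, add_smul, add_smul, f.map_add, hx, hy]
    | hmul x y hx hy => rw [op_mul, mul_smul, mul_smul, hy, hx]

/-- The underlying `K`-linear map of an element of the Schur algebra. -/
noncomputable def SchurB.toEnd (s : SchurB Q q n d) : Module.End K (TensorSpace K n d) := s.restrictScalars K

theorem SchurB.toEnd_apply (s : SchurB Q q n d) (v : TensorSpace K n d) : s.toEnd v = s v := rfl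

theorem SchurB.toEnd_injective : Function.Injective (SchurB.toEnd (Q := Q) (q := q) (n := n) (d := d)) :=
  LinearMap.restrictScalars_injective K

theorem SchurB.toEnd_mul_genAct (s : SchurB Q q n d) (t : Fin d) :
    s.toEnd * genAct Q q n t = genAct Q q n t * s.toEnd := by
  ext v
  rw [Module.End.mul_apply, Module.End.mul_apply, toEnd_apply, toEnd_apply, ← op_T_smul_eq,
    ← op_T_smul_eq, map_smul]

/-- Transposition on the Schur algebra with respect to the basis `v_μ`. -/
noncomputable def SchurB.transpose (s : SchurB Q q n d) : SchurB Q q n d :=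
  SchurB.ofCommute (transposeEnd (tensorBasis K n d) s.toEnd) fun t => by
    conv_lhs => rw [← transposeEnd_genAct, ← transposeEnd_mul, ← s.toEnd_mul_genAct,
      transposeEnd_mul, transposeEnd_genAct]

theorem SchurB.toEnd_transpose (s : SchurB Q q n d) :
    s.transpose.toEnd = transposeEnd (tensorBasis K n d) s.toEnd := rfl

theorem SchurB.transpose_transpose (s : SchurB Q q n d) : s.transpose.transpose = s := by
  apply SchurB.toEnd_injective
  rw [toEnd_transpose, toEnd_transpose, transposeEnd_transposeEnd]

theorem SchurB.transpose_mul (s s' : SchurB Q q n d) :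
    (s * s').transpose = s'.transpose * s.transpose := by
  apply SchurB.toEnd_injective
  have h : ∀ a b : SchurB Q q n d, (a * b).toEnd = a.toEnd * b.toEnd := fun _ _ => rfl
  rw [toEnd_transpose, h, h, transposeEnd_mul, toEnd_transpose, toEnd_transpose]

theorem SchurB.transpose_add (s s' : SchurB Q q n d) :
    (s + s').transpose = s.transpose + s'.transpose := by
  apply SchurB.toEnd_injective
  have h : ∀ a b : SchurB Q q n d, (a + b).toEnd = a.toEnd + b.toEnd := fun _ _ => rfl
  rw [toEnd_transpose, h, h, transposeEnd_add, toEnd_transpose, toEnd_transpose]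

theorem SchurB.transpose_algebraMap (c : K) :
    (algebraMap K (SchurB Q q n d) c).transpose = algebraMap K (SchurB Q q n d) c := by
  apply SchurB.toEnd_injective
  have h : (algebraMap K (SchurB Q q n d) c).toEnd = c • 1 := rfl
  rw [toEnd_transpose, h, transposeEnd_smul, transposeEnd_one]

variable (Q q n d) in
/-- Transposition as an anti-automorphism of the Schur algebra. -/
noncomputable def SchurB.transposeEquiv : SchurB Q q n d ≃ₐ[K] (SchurB Q q n d)ᵐᵒᵖ where
  toFun s := op s.transpose
  invFun s := s.unop.transpose
  left_inv s := s.transpose_transpose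
  right_inv s := unop_injective s.unop.transpose_transpose
  map_mul' s s' := unop_injective (s.transpose_mul s')
  map_add' s s' := unop_injective (s.transpose_add s')
  commutes' c := unop_injective (transpose_algebraMap c)

theorem SchurB.repr_transposeEquiv (s : SchurB Q q n d) (μ ν : Fin d → Idx n) :
    (tensorBasis K n d).repr ((transposeEquiv Q q n d s).unop (tensorBasis K n d μ)) ν =
      (tensorBasis K n d).repr (s (tensorBasis K n d ν)) μ :=
  repr_transposeEnd (tensorBasis K n d) s.toEnd μ ν

theorem SchurB.transposeEquiv_eq_op {s : SchurB Q q n d}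
    (hs : transposeEnd (tensorBasis K n d) s.toEnd = s.toEnd) : transposeEquiv Q q n d s = op s :=
  unop_injective (SchurB.toEnd_injective hs)

end SchurTranspose

/-! ### The free orbit of v_1 ⊗ ⋯ ⊗ v_d and its projection. -/

section Orbit

variable {K : Type u} [Field K] (Q q : Kˣ) {n d : ℕ} (hd : d ≤ n / 2)

/-- The multi-index given by the entries of a signed permutation. -/
def SignedPerm.toIdx (w : SignedPerm d) (i : Fin d) : Idx n :=
  ⟨w.val i, by
    have h := w.natAbs_val i
    have h1 := (w.1 i).2
    simp only [Finset.mem_filter, Finset.mem_Icc]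
    -- Entries have absolute value between 1 and d ≤ ⌊n/2⌋, so it does not matter whether 0 belongs
    -- to I(n).
    exact ⟨⟨by omega, by omega⟩, Or.inr (by omega)⟩⟩

theorem SignedPerm.toIdx_injective :
    Function.Injective (SignedPerm.toIdx (n := n) hd) := fun _ _ h =>
  SignedPerm.ext_val fun i => congrArg Subtype.val (congrFun h i)

theorem SignedPerm.placeAct_toIdx (u : Fin d) (w : SignedPerm d) :
    placeAct u (w.toIdx (n := n) hd) = (w.right u).toIdx hd := by
  funext i
  refine Subtype.ext ?_
  change _ = (w.right u).val i
  rw [SignedPerm.val_right, placeAct]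
  split_ifs with h1 h2
  · subst h2; simp [Idx.neg, SignedPerm.toIdx]
  · simp [Function.update_of_ne h2, SignedPerm.toIdx]
  · rfl

theorem SignedPerm.placeAct_mem_range_iff (u : Fin d) (μ : Fin d → Idx n) :
    placeAct u μ ∈ Set.range (SignedPerm.toIdx (n := n) hd) ↔
      μ ∈ Set.range (SignedPerm.toIdx (n := n) hd) := by
  constructor
  · rintro ⟨w, hw⟩
    exact ⟨w.right u, by rw [← SignedPerm.placeAct_toIdx, hw, placeAct_placeAct]⟩
  · rintro ⟨w, rfl⟩
    exact ⟨w.right u, (SignedPerm.placeAct_toIdx hd u w).symm⟩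

variable (K) in
/-- The basis vectors of the tensor space in the orbit of `v_1 ⊗ ⋯ ⊗ v_d`. -/
noncomputable def orbitVec (w : SignedPerm d) : TensorSpace K n d :=
  tensorBasis K n d (w.toIdx hd)

-- Entries in the orbit are nonzero and pairwise distinct, so the cases with a factor Q⁻¹ or q⁻¹
-- never occur and the formula of the regular module remains.
open scoped Classical in
theorem genAct_orbitVec (u : Fin d) (w : SignedPerm d) :
    genAct Q q n u (orbitVec K hd w) =
      orbitVec K hd (w.right u) + (if w.Desc u then quadCoeff Q q u else 0) • orbitVec K hd w := by
  have h1 : swapCoeff (K := K) Q q u (w.toIdx (n := n) hd) = 1 := by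
    unfold swapCoeff
    split_ifs with h1 h2 h2
    · have : 0 = w.val u := h2
      have := w.val_pos_or_neg u
      omega
    · rfl
    · exact absurd (congrArg Subtype.val h2) (w.val_ne_val (SignedPerm.prevPos_ne h1))
    · rfl
  have h2 : diagCoeff (K := K) Q q u (w.toIdx (n := n) hd) =
      if w.Desc u then quadCoeff Q q u else 0 := by
    unfold diagCoeff SignedPerm.Desc quadCoeff
    by_cases hu : u.val = 0
    · simp only [if_pos hu]; rfl
    · simp only [if_neg hu]; rfl
  rw [orbitVec, genAct_basis, h1, h2, one_smul, SignedPerm.placeAct_toIdx]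
  rfl

open scoped Classical in
/-- The projection of the tensor space to the span of the orbit of `v_1 ⊗ ⋯ ⊗ v_d`. -/
noncomputable def orbitProjEnd : Module.End K (TensorSpace K n d) :=
  (tensorBasis K n d).constr K fun μ =>
    (if μ ∈ Set.range (SignedPerm.toIdx (n := n) hd) then (1 : K) else 0) • tensorBasis K n d μ

open scoped Classical in
theorem orbitProjEnd_basis (μ : Fin d → Idx n) :
    orbitProjEnd hd (tensorBasis K n d μ) =
      (if μ ∈ Set.range (SignedPerm.toIdx (n := n) hd) then (1 : K) else 0) •
        tensorBasis K n d μ := by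
  rw [orbitProjEnd, Module.Basis.constr_basis]

theorem orbitProjEnd_orbitVec (w : SignedPerm d) :
    orbitProjEnd hd (orbitVec K hd w) = orbitVec K hd w := by
  classical
  rw [orbitVec, orbitProjEnd_basis, if_pos ⟨w, rfl⟩, one_smul]

theorem orbitProjEnd_mem (v : TensorSpace K n d) :
    orbitProjEnd hd v ∈ Submodule.span K (Set.range (orbitVec K hd)) := by
  classical
  induction (tensorBasis K n d).mem_span v using Submodule.span_induction with
  | zero => simp
  | add v w _ _ hv hw => rw [map_add]; exact add_mem hv hw
  | smul c v _ hv => rw [map_smul]; exact Submodule.smul_mem _ _ hv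
  | mem v hv =>
    obtain ⟨μ, rfl⟩ := hv
    rw [orbitProjEnd_basis]
    split_ifs with h
    · obtain ⟨w, rfl⟩ := h
      exact Submodule.smul_mem _ _ (Submodule.subset_span ⟨w, rfl⟩)
    · simp

/-- The reflections preserve both the orbit and its complement in the index set, hence T_t respects
the decomposition. -/
theorem orbitProjEnd_comm (t : Fin d) :
    orbitProjEnd hd * genAct Q q n t = genAct (K := K) Q q n t * orbitProjEnd hd := by
  classical
  refine (tensorBasis K n d).ext fun μ => ?_
  simp only [Module.End.mul_apply, genAct_basis, orbitProjEnd_basis, map_add, map_smul,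
    SignedPerm.placeAct_mem_range_iff]
  split_ifs <;> simp

/-- The idempotent of the Schur algebra that projects to the orbit of `v_1 ⊗ ⋯ ⊗ v_d`. -/
noncomputable def orbitProj : SchurB Q q n d :=
  SchurB.ofCommute (orbitProjEnd hd) (orbitProjEnd_comm Q q hd)

theorem transposeEnd_orbitProjEnd :
    transposeEnd (tensorBasis K n d) (orbitProjEnd hd) = orbitProjEnd hd := by
  classical
  refine transposeEnd_eq_self_of_involution _ _ id (fun _ => 0)
    (fun μ => if μ ∈ Set.range (SignedPerm.toIdx (n := n) hd) then (1 : K) else 0)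
    (fun _ => rfl) (fun _ => rfl) fun μ => ?_
  rw [orbitProjEnd_basis, zero_smul, zero_add]

/-! ### Left multiplication by generators on the orbit. -/

open scoped Classical in
/-- Left multiplication by the simple reflection `s_t` on the orbit of `(1, …, d)`, extended by the
identity. -/
noncomputable def leftIdx (t : Fin d) (μ : Fin d → Idx n) : Fin d → Idx n :=
  if h : μ ∈ Set.range (SignedPerm.toIdx (n := n) hd) then (h.choose.left t).toIdx hd else μ

theorem leftIdx_toIdx (t : Fin d) (w : SignedPerm d) :
    leftIdx (n := n) hd t (w.toIdx hd) = (w.left t).toIdx hd := by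
  have h : w.toIdx (n := n) hd ∈ Set.range (SignedPerm.toIdx (n := n) hd) := ⟨w, rfl⟩
  rw [leftIdx, dif_pos h, SignedPerm.toIdx_injective hd h.choose_spec]

theorem leftIdx_of_notMem (t : Fin d) {μ : Fin d → Idx n}
    (h : μ ∉ Set.range (SignedPerm.toIdx (n := n) hd)) : leftIdx hd t μ = μ := by
  rw [leftIdx, dif_neg h]

theorem leftIdx_leftIdx (t : Fin d) (μ : Fin d → Idx n) :
    leftIdx hd t (leftIdx hd t μ) = μ := by
  by_cases h : μ ∈ Set.range (SignedPerm.toIdx (n := n) hd)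
  · obtain ⟨w, rfl⟩ := h
    rw [leftIdx_toIdx, leftIdx_toIdx, SignedPerm.left_left]
  · rw [leftIdx_of_notMem hd t h, leftIdx_of_notMem hd t h]

theorem leftIdx_mem_range_iff (t : Fin d) (μ : Fin d → Idx n) :
    leftIdx hd t μ ∈ Set.range (SignedPerm.toIdx (n := n) hd) ↔
      μ ∈ Set.range (SignedPerm.toIdx (n := n) hd) := by
  by_cases h : μ ∈ Set.range (SignedPerm.toIdx (n := n) hd)
  · obtain ⟨w, rfl⟩ := h
    rw [leftIdx_toIdx]
    exact ⟨fun _ => ⟨w, rfl⟩, fun _ => ⟨_, rfl⟩⟩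
  · rw [leftIdx_of_notMem hd t h]

open scoped Classical in
/-- Left multiplication by `T_t` on the span of the orbit of `v_1 ⊗ ⋯ ⊗ v_d`, where this span is
identified with the regular module, extended by zero. -/
noncomputable def leftMulEnd (t : Fin d) : Module.End K (TensorSpace K n d) :=
  (tensorBasis K n d).constr K fun μ =>
    (if μ ∈ Set.range (SignedPerm.toIdx (n := n) hd) then (1 : K) else 0) •
      tensorBasis K n d (leftIdx hd t μ) +
    (if ∃ w : SignedPerm d, w.toIdx hd = μ ∧ w.inv.Desc t then quadCoeff Q q t else 0) •
      tensorBasis K n d μ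

theorem transposeEnd_leftMulEnd (t : Fin d) :
    transposeEnd (tensorBasis K n d) (leftMulEnd Q q hd t) = leftMulEnd Q q hd t := by
  classical
  -- The symmetry criterion needs an involution of all indices, which is why `leftIdx` is the
  -- identity off the orbit; the coefficients vanish there.
  refine transposeEnd_eq_self_of_involution _ _ (leftIdx hd t) _ _ (leftIdx_leftIdx hd t) ?_
    fun μ => by rw [leftMulEnd, Module.Basis.constr_basis]
  intro μ
  simp only [leftIdx_mem_range_iff]

theorem leftMulEnd_of_notMem (t : Fin d) {μ : Fin d → Idx n}
    (h : μ ∉ Set.range (SignedPerm.toIdx (n := n) hd)) :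
    leftMulEnd Q q hd t (tensorBasis K n d μ) = 0 := by
  rw [leftMulEnd, Module.Basis.constr_basis, if_neg h, if_neg, zero_smul, zero_smul, add_zero]
  rintro ⟨w, hw, -⟩
  exact h ⟨w, hw⟩

open scoped Classical in
theorem leftMulEnd_orbitVec (t : Fin d) (w : SignedPerm d) :
    leftMulEnd Q q hd t (orbitVec K hd w) =
      orbitVec K hd (w.left t) +
        (if w.inv.Desc t then quadCoeff Q q t else 0) • orbitVec K hd w := by
  have h : (∃ x : SignedPerm d, x.toIdx (n := n) hd = w.toIdx hd ∧ x.inv.Desc t) ↔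
      w.inv.Desc t :=
    ⟨fun ⟨x, hx, hx'⟩ => SignedPerm.toIdx_injective hd hx ▸ hx', fun h => ⟨w, rfl, h⟩⟩
  rw [orbitVec, leftMulEnd, Module.Basis.constr_basis, if_pos ⟨w, rfl⟩, one_smul, leftIdx_toIdx]
  simp only [h]
  rfl

/-- Left and right multiplication commute on W, so only the descent terms matter. If s_t w ≠ w s_u,
neither multiplication affects the descents that govern the other. If they are equal, both operators
have the same parameter and act identically on the vectors of w and w s_u. -/
theorem leftMulEnd_comm (t u : Fin d) :
    leftMulEnd Q q hd t * genAct Q q n u = genAct (K := K) Q q n u * leftMulEnd Q q hd t := by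
  classical
  refine (tensorBasis K n d).ext fun μ => ?_
  rw [Module.End.mul_apply, Module.End.mul_apply]
  by_cases hμ : μ ∈ Set.range (SignedPerm.toIdx (n := n) hd)
  · obtain ⟨w, rfl⟩ := hμ
    change leftMulEnd Q q hd t (genAct Q q n u (orbitVec K hd w)) =
      genAct Q q n u (leftMulEnd Q q hd t (orbitVec K hd w))
    simp only [genAct_orbitVec, leftMulEnd_orbitVec, map_add, map_smul, SignedPerm.left_right]
    by_cases h : w.left t = w.right u
    · have h1 := SignedPerm.desc_iff_of_left_eq_right h
      have h2 : (w.right u).inv.Desc t ↔ ¬ w.inv.Desc t := by rw [← h, SignedPerm.desc_inv_left]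
      have h3 : (w.right u).Desc u ↔ ¬ w.inv.Desc t := by rw [SignedPerm.desc_right, h1]
      have h4 : quadCoeff Q q t = quadCoeff Q q u := by
        simp only [quadCoeff, SignedPerm.zero_iff_of_left_eq_right h]
      simp only [h2, h3, h1, h4, h]
    · simp only [SignedPerm.desc_left h, SignedPerm.desc_inv_right h]
      module
  · rw [genAct_basis, map_add, map_smul, map_smul, leftMulEnd_of_notMem Q q hd t hμ,
      leftMulEnd_of_notMem Q q hd t
        (fun h => hμ ((SignedPerm.placeAct_mem_range_iff hd u μ).1 h))]
    simp

/-- Left multiplication by `T_t` on the orbit of `v_1 ⊗ ⋯ ⊗ v_d` as an element of the Schur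
algebra. -/
noncomputable def leftMul (t : Fin d) : SchurB Q q n d :=
  SchurB.ofCommute (leftMulEnd Q q hd t) (leftMulEnd_comm Q q hd t)

theorem transposeEquiv_leftMul (t : Fin d) :
    SchurB.transposeEquiv Q q n d (leftMul Q q hd t) = op (leftMul Q q hd t) :=
  SchurB.transposeEquiv_eq_op (s := leftMul Q q hd t) (transposeEnd_leftMulEnd Q q hd t)

theorem transposeEquiv_orbitProj :
    SchurB.transposeEquiv Q q n d (orbitProj Q q hd) = op (orbitProj Q q hd) :=
  SchurB.transposeEquiv_eq_op (s := orbitProj Q q hd) (transposeEnd_orbitProjEnd hd)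

theorem leftMul_mul_orbitProj (t : Fin d) :
    leftMul Q q hd t * orbitProj Q q hd = leftMul (n := n) Q q hd t := by
  classical
  apply SchurB.toEnd_injective
  refine (tensorBasis K n d).ext fun μ => ?_
  change leftMulEnd Q q hd t (orbitProjEnd hd _) = leftMulEnd Q q hd t _
  rw [orbitProjEnd_basis, map_smul]
  split_ifs with h
  · rw [one_smul]
  · rw [leftMulEnd_of_notMem Q q hd t h, smul_zero]

/-! ### The orbit span as the regular module, and the idempotent. -/

/-- The map `h ↦ v_1 ⊗ ⋯ ⊗ v_d · h`. -/
noncomputable def orbitMap : HeckeB Q q d →ₗ[(HeckeB Q q d)ᵐᵒᵖ] TensorSpace K n d where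
  toFun h := op h • orbitVec K hd (SignedPerm.one d)
  map_add' x y := by rw [op_add, add_smul]
  map_smul' h x := by rw [RingHom.id_apply, ← mul_smul]; rfl

theorem orbitMap_apply (h : HeckeB Q q d) :
    orbitMap Q q hd h = op h • orbitVec (n := n) K hd (SignedPerm.one d) := rfl

/-- At an ascent the generator sends an orbit vector to the next one without a correction term. -/
theorem orbitVec_mem_range (w : SignedPerm d) :
    ∃ h, orbitMap Q q hd h = orbitVec (n := n) K hd w := by
  classical
  induction w using SignedPerm.induction_ascent with
  | h1 => exact ⟨1, by rw [orbitMap_apply, op_one, one_smul]⟩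
  | hs u w hu ih =>
    obtain ⟨h, hh⟩ := ih
    refine ⟨h * HeckeB.T Q q u, ?_⟩
    rw [orbitMap_apply, op_mul, mul_smul, ← orbitMap_apply, hh, op_T_smul_eq, genAct_orbitVec,
      if_neg hu, zero_smul, add_zero]

theorem range_orbitMap : LinearMap.range ((orbitMap (n := n) Q q hd).restrictScalars K) =
    Submodule.span K (Set.range (orbitVec K hd)) := by
  apply le_antisymm
  · rintro _ ⟨h, rfl⟩
    change orbitMap Q q hd h ∈ _
    -- The projection is H-linear and fixes v₀, so it fixes v₀h.
    have h1 : orbitMap Q q hd h = orbitProjEnd hd (orbitMap Q q hd h) := by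
      rw [orbitMap_apply]
      change _ = orbitProj Q q hd _
      rw [map_smul]
      congr 1
      exact (orbitProjEnd_orbitVec hd _).symm
    rw [h1]
    exact orbitProjEnd_mem hd _
  · rw [Submodule.span_le]
    rintro _ ⟨w, rfl⟩
    exact orbitVec_mem_range Q q hd w

theorem finrank_span_orbitVec :
    Module.finrank K (Submodule.span K (Set.range (orbitVec (n := n) K hd))) =
      2 ^ d * d.factorial := by
  rw [finrank_span_eq_card, SignedPerm.card]
  exact (tensorBasis K n d).linearIndependent.comp _ (SignedPerm.toIdx_injective hd)

/-- A dimension count: the image has dimension 2^d d!, and the source has at most that dimension. -/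
theorem orbitMap_injective : Function.Injective (orbitMap (n := n) Q q hd) := by
  have := HeckeB.finite Q q (d := d)
  have h := LinearMap.finrank_range_add_finrank_ker ((orbitMap (n := n) Q q hd).restrictScalars K)
  rw [range_orbitMap, finrank_span_orbitVec] at h
  have h1 := HeckeB.finrank_le Q q (d := d)
  have h2 : LinearMap.ker ((orbitMap (n := n) Q q hd).restrictScalars K) = ⊥ :=
    Submodule.finrank_eq_zero.1 (by omega)
  exact fun x y hxy => LinearMap.ker_eq_bot.1 h2 hxy

theorem orbitProj_mem_range (v : TensorSpace K n d) :
    orbitProj Q q hd v ∈ LinearMap.range (orbitMap (n := n) Q q hd) := by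
  have h : orbitProjEnd hd v ∈ LinearMap.range ((orbitMap (n := n) Q q hd).restrictScalars K) := by
    rw [range_orbitMap]
    exact orbitProjEnd_mem hd v
  exact h

/-- The coordinate of a tensor in the regular module spanned by the orbit of
`v_1 ⊗ ⋯ ⊗ v_d`. -/
noncomputable def orbitCoord : TensorSpace K n d →ₗ[(HeckeB Q q d)ᵐᵒᵖ] HeckeB Q q d :=
  (LinearEquiv.ofInjective (orbitMap (n := n) Q q hd)
      (orbitMap_injective Q q hd)).symm.toLinearMap ∘ₗ
    LinearMap.codRestrict _ (orbitProj Q q hd) (orbitProj_mem_range Q q hd)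

theorem orbitMap_orbitCoord (v : TensorSpace K n d) :
    orbitMap Q q hd (orbitCoord Q q hd v) = orbitProj Q q hd v :=
  congrArg Subtype.val ((LinearEquiv.ofInjective (orbitMap (n := n) Q q hd)
    (orbitMap_injective Q q hd)).apply_symm_apply ⟨_, orbitProj_mem_range Q q hd v⟩)

theorem orbitCoord_base : orbitCoord Q q hd (orbitVec (n := n) K hd (SignedPerm.one d)) = 1 := by
  apply orbitMap_injective (n := n) Q q hd
  rw [orbitMap_orbitCoord, orbitMap_apply, op_one, one_smul]
  exact orbitProjEnd_orbitVec hd _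

theorem rankOne_orbitCoord :
    rankOne (orbitCoord Q q hd) (orbitVec (n := n) K hd (SignedPerm.one d)) =
      orbitProj Q q hd := by
  ext v
  exact orbitMap_orbitCoord Q q hd v

/-- An endomorphism s with se = s is determined by its value at v₀. Both sides send v₀ to the orbit
vector of s_t, since the identity has no descents. -/
theorem rankOne_orbitCoord_T (t : Fin d) :
    rankOne (orbitCoord Q q hd) (op (HeckeB.T Q q t) • orbitVec (n := n) K hd (SignedPerm.one d)) =
      leftMul Q q hd t := by
  classical
  rw [← eq_rankOne_of_mul_base (orbitCoord Q q hd)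
    (v₀ := orbitVec (n := n) K hd (SignedPerm.one d)) (s := leftMul Q q hd t)
    (by rw [rankOne_orbitCoord, leftMul_mul_orbitProj])]
  congr 1
  rw [op_T_smul_eq, genAct_orbitVec, if_neg (SignedPerm.not_desc_one t)]
  change _ = leftMulEnd Q q hd t _
  rw [leftMulEnd_orbitVec, SignedPerm.inv_one, if_neg (SignedPerm.not_desc_one t),
    SignedPerm.left_one]

/-- This is τψ⁻¹ = ψ⁻¹σ. Both composites are K-linear and reverse products, so agreement on the
generators suffices, and there it is the symmetry of `leftMul`. -/
theorem transposeEquiv_rankOne (h : HeckeB Q q d) :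
    (SchurB.transposeEquiv Q q n d (rankOne (orbitCoord Q q hd)
      (op h • orbitVec (n := n) K hd (SignedPerm.one d)))).unop =
    rankOne (orbitCoord Q q hd)
      (op (HeckeB.anti Q q d h).unop • orbitVec (n := n) K hd (SignedPerm.one d)) := by
  induction h using HeckeB.induction with
  | hT t =>
    rw [HeckeB.anti_T, unop_op, rankOne_orbitCoord_T, transposeEquiv_leftMul, unop_op]
  | hK c =>
    have h1 : rankOne (orbitCoord Q q hd) (op (algebraMap K (HeckeB Q q d) c) •
        orbitVec (n := n) K hd (SignedPerm.one d)) = c • orbitProj Q q hd := by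
      rw [Algebra.algebraMap_eq_smul_one, op_smul, op_one, smul_assoc, one_smul,
        ← rankOne_orbitCoord]
      ext v
      simp only [rankOne_apply, LinearMap.smul_apply]
      rw [smul_comm]
    have h2 : (HeckeB.anti Q q d (algebraMap K _ c)).unop = algebraMap K _ c := by
      rw [AlgEquiv.commutes, MulOpposite.algebraMap_apply, unop_op]
    rw [h2, h1, map_smul, transposeEquiv_orbitProj, unop_smul, unop_op]
  | hadd x y hx hy =>
    rw [op_add, add_smul, rankOne_add, map_add, unop_add, hx, hy, map_add, unop_add, op_add,
      add_smul, rankOne_add]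
  | hmul x y hx hy =>
    have hm : ∀ x y : HeckeB Q q d,
        rankOne (orbitCoord Q q hd) (op (x * y) • orbitVec (n := n) K hd (SignedPerm.one d)) =
          rankOne (orbitCoord Q q hd) (op x • orbitVec (n := n) K hd (SignedPerm.one d)) *
          rankOne (orbitCoord Q q hd) (op y • orbitVec (n := n) K hd (SignedPerm.one d)) := by
      intro x y
      rw [mul_rankOne, map_smul, rankOne_apply_base _ (orbitCoord_base Q q hd), op_mul, mul_smul]
    rw [hm, map_mul, unop_mul, hx, hy, map_mul, unop_mul, hm]

end Orbit

end TypeB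

theorem proposition4p1 {K : Type u} [Field K] (Q q : Kˣ) (n d : ℕ) (hd : d ≤ n / 2) :
    ∃ (e : TypeB.SchurB Q q n d) (he : IsIdempotentElem e)
      (ψ : he.Corner ≃ₐ[K] TypeB.HeckeB Q q d),
      -- `S e ≅ V^{⊗d}` as `(S, H)`-bimodules, where `H` acts on `S e` on the right through `ψ`
      (∃ Φ : TypeB.TensorSpace K n d ≃ₗ[TypeB.SchurB Q q n d]
            Submodule.span (TypeB.SchurB Q q n d) {e},
          ∀ (v : TypeB.TensorSpace K n d) (h : TypeB.HeckeB Q q d),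
            (Φ (op h • v)).1 = (Φ v).1 * (ψ.symm h).1) ∧
      -- `e S ≅ V^{⊗d}` as `(S, H)`-bimodules, where `S` and `H` act on `e S` through right and
      -- left multiplication and the standard anti-automorphisms: transposition `τ` on `S`, and
      -- the anti-automorphism `σ` of `H` that fixes all `T_t`
      (∃ (τ : TypeB.SchurB Q q n d ≃ₐ[K] (TypeB.SchurB Q q n d)ᵐᵒᵖ)
          (σ : TypeB.HeckeB Q q d ≃ₐ[K] (TypeB.HeckeB Q q d)ᵐᵒᵖ),
          (∀ (s : TypeB.SchurB Q q n d) (μ ν : Fin d → TypeB.Idx n),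
            (TypeB.tensorBasis K n d).repr ((τ s).unop (TypeB.tensorBasis K n d μ)) ν =
              (TypeB.tensorBasis K n d).repr (s (TypeB.tensorBasis K n d ν)) μ) ∧
          (∀ t : Fin d, σ (TypeB.HeckeB.T Q q t) = op (TypeB.HeckeB.T Q q t)) ∧
          ∃ Θ : TypeB.TensorSpace K n d ≃+ Submodule.span (TypeB.SchurB Q q n d)ᵐᵒᵖ {e},
            (∀ (s : TypeB.SchurB Q q n d) (v : TypeB.TensorSpace K n d),
              (Θ (s • v)).1 = (Θ v).1 * (τ s).unop) ∧
            (∀ (v : TypeB.TensorSpace K n d) (h : TypeB.HeckeB Q q d),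
              (Θ (op h • v)).1 = (ψ.symm (σ h).unop).1 * (Θ v).1)) ∧
      -- the Schur functor `M ↦ e M` from `S`-modules to `H`-modules
      (∃ (F : CategoryTheory.Functor (ModuleCat.{w} (TypeB.SchurB Q q n d))
            (ModuleCat.{w} (TypeB.HeckeB Q q d)))
          (η : ∀ M : ModuleCat.{w} (TypeB.SchurB Q q n d), F.obj M ≃+ TypeB.idemPart e M),
          (∀ (M : ModuleCat.{w} (TypeB.SchurB Q q n d)) (h : TypeB.HeckeB Q q d) (x : F.obj M),
            (η M (h • x)).1 = (ψ.symm h).1 • (η M x).1) ∧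
          (∀ (M N : ModuleCat.{w} (TypeB.SchurB Q q n d)) (f : M ⟶ N) (x : F.obj M),
            (η N ((F.map f).hom x)).1 = f.hom (η M x).1)) := by
  have hβ := TypeB.orbitCoord_base (n := n) Q q hd
  have hτ : TypeB.SchurB.transposeEquiv Q q n d (TypeB.rankOne (TypeB.orbitCoord Q q hd)
      (TypeB.orbitVec K hd (TypeB.SignedPerm.one d))) = op (TypeB.rankOne
      (TypeB.orbitCoord Q q hd) (TypeB.orbitVec K hd (TypeB.SignedPerm.one d))) := by
    rw [TypeB.rankOne_orbitCoord, TypeB.transposeEquiv_orbitProj]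
  refine ⟨_, TypeB.isIdempotentElem_rankOne _ hβ, TypeB.cornerEquiv _ hβ,
    ⟨TypeB.leftIdealEquiv _ hβ, TypeB.leftIdealEquiv_smul _ hβ⟩,
    ⟨TypeB.SchurB.transposeEquiv Q q n d, TypeB.HeckeB.anti Q q d,
      TypeB.SchurB.repr_transposeEquiv, TypeB.HeckeB.anti_T Q q,
      TypeB.rightIdealEquiv _ hβ _ hτ, TypeB.rightIdealEquiv_smul _ hβ _ hτ, fun v h => ?_⟩,
    TypeB.exists_idemFunctor _ (TypeB.cornerEquiv (K := K) _ hβ).symm.toAlgHom.toRingHom⟩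
  rw [TypeB.rightIdealEquiv_op_smul, TypeB.transposeEquiv_rankOne, TypeB.cornerEquiv_symm_apply]
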